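/- For $W\ge 1$ let $\mathbb Z_W=\mathbb Z\times\{1,\dots,W\}$, and consider the random operator $$(H\Psi)_n=-\Psi_{n-1}-\Psi_{n+1}+S_n\Psi_n,\qquad S_n=\operatorname{diag}(V_{(n,1)},\dots,V_{(n,W)})-U_n ,$$ on functions $\Psi$ on $\mathbb Z_W$. Here $(V_i)_{i\in\mathbb Z_W}$ are i.i.d. real random variables with a density $\rho\le D_0<\infty$, and the $U_n$, $n\in\mathbb Z$, are random real symmetric $W\times W$ matrices with $U_n(x,y)=0$ for $|x-y|>d$ ($d$ a positive integer) such that the family $(U_n)$ is independent of the family $(V_i)$. Assume that $$\mathbb P(|V_i|\ge T)\le D_1/T,\qquad \mathbb P(\|U_n\|\ge T)\le D_1/T,\qquad T\ge 1,$$ for all $i$ and $n$, where $\|\cdot\|$ is the operator norm on Euclidean space. Assume also that for any finite family of pairwise disjoint rectangular sets $\Lambda_1,\dots,\Lambda_k\subset\mathbb Z_W$ the collections $\{U_n(x,y):(n,x),(n,y)\in\Lambda_i\}$, $i=1,\dots,k$, are independent (this holds in particular if the $U_n$ are deterministic); a rectangular set is a finite product of two intervals of integers. For finite $\Lambda\subset\mathbb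 Z_W$ let $H_\Lambda$ be the restriction of $H$ to $\Lambda$ with Dirichlet boundary conditions, and let $f_\Lambda^E=\det(H_\Lambda-E)$. **Theorem.** There is an absolute constant $K_0$ such that the following holds. Let $\epsilon>0$ and $E\in\mathbb R$. There exists a constant $C_0=C_0(d,D_0,D_1,|E|,\epsilon)$, which in particular does not depend on $W$, such that for any $K\ge K_0$ and any rectangular set $\Lambda\subset\mathbb Z_W$ with $|\Lambda|\ge C_0$ the determinant $f_\Lambda^E$ is almost surely nonzero, $\log|f_\Lambda^E|$ is integrable, and $$\mathbb P\left(\left|\log|f_\Lambda^E|-\mathbb E\left(\log|f_\Lambda^E|\right)\right|>|\Lambda|^{1/2+\epsilon}K\right)\le\exp(-K/2).$$ -/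

import Mathlib

open MeasureTheory ProbabilityTheory

noncomputable section

/-- The strip of width `W`: the product of `ℤ` with a set of `W` consecutive integers
(which are labelled by `Fin W`). -/
abbrev Strip (W : ℕ) : Type := ℤ × Fin W

/-- The operator `(HΨ)_n = -Ψ_{n-1} - Ψ_{n+1} + S_n Ψ_n` on functions on the strip, where
`S_n = diag(V_{(n,1)}, …, V_{(n,W)}) - U_n`, for one realization `v` of the potentials and
`u` of the matrices. -/
def stripOperator {W : ℕ} (v : Strip W → ℝ) (u : ℤ → Matrix (Fin W) (Fin W) ℝ)
    (ψ : Strip W → ℝ) : Strip W → ℝ := fun i =>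
  -ψ (i.1 - 1, i.2) - ψ (i.1 + 1, i.2) +
    ((Matrix.diagonal (fun x => v (i.1, x)) - u i.1).mulVec (fun y => ψ (i.1, y))) i.2

/-- The restriction `H_Λ` of the operator to a finite set `Λ`, with Dirichlet boundary
conditions, as a matrix: the `(i, j)` entry is `⟨δ_i, H δ_j⟩`, for `i, j ∈ Λ`. -/
def dirichletRestriction {W : ℕ} (v : Strip W → ℝ) (u : ℤ → Matrix (Fin W) (Fin W) ℝ)
    (Λ : Finset (Strip W)) : Matrix Λ Λ ℝ :=
  Matrix.of fun i j => stripOperator v u (Pi.single (j : Strip W) 1) (i : Strip W)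

/-- The entries of `H_Λ`, spelled out. -/
theorem dirichletRestriction_apply {W : ℕ} (v : Strip W → ℝ)
    (u : ℤ → Matrix (Fin W) (Fin W) ℝ) (Λ : Finset (Strip W)) (i j : Λ) :
    dirichletRestriction v u Λ i j =
      (if i.1.2 = j.1.2 ∧ |i.1.1 - j.1.1| = 1 then -1 else 0) +
      (if i = j then v i.1 else 0) -
      (if i.1.1 = j.1.1 then u i.1.1 i.1.2 j.1.2 else 0) := by
  obtain ⟨⟨n, x⟩, hi⟩ := i
  obtain ⟨⟨m, y⟩, hj⟩ := j
  have h1 : ∀ z : Fin W, (Pi.single ((m, y) : Strip W) (1 : ℝ) : Strip W → ℝ) (n, z) =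
      if n = m then (Pi.single y (1 : ℝ) : Fin W → ℝ) z else 0 := by
    intro z
    by_cases h : n = m <;> by_cases h' : z = y <;> simp [h, h']
  simp only [dirichletRestriction, stripOperator, Matrix.of_apply, h1]
  by_cases h : n = m
  · subst h
    by_cases h' : x = y <;>
      simp [Pi.single_apply, Matrix.mulVec, dotProduct, Matrix.diagonal_apply, h']
  · have e : |n - m| = 1 ↔ (n - 1 = m ∨ n + 1 = m) := by
      rw [abs_eq (by norm_num)]; omega
    have e2 : (fun _ : Fin W => (0 : ℝ)) = 0 := rfl
    simp only [h, if_false, e2, Matrix.mulVec_zero]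
    by_cases h' : x = y
    · by_cases h2 : n - 1 = m
      · have h3 : n + 1 ≠ m := by omega
        simp [h, h', e, h2, h3]
      · by_cases h3 : n + 1 = m <;> simp [h, h', e, h2, h3]
    · simp [h, h']

/-- The Dirichlet determinant `f_Λ^E = det (H_Λ - E)`. -/
def dirichletDet {W : ℕ} (v : Strip W → ℝ) (u : ℤ → Matrix (Fin W) (Fin W) ℝ)
    (E : ℝ) (Λ : Finset (Strip W)) : ℝ :=
  (dirichletRestriction v u Λ - E • (1 : Matrix Λ Λ ℝ)).det

/-- A rectangular subset of the strip: a product of two intervals of integers. -/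
def IsRectangular {W : ℕ} (Λ : Finset (Strip W)) : Prop :=
  ∃ (a b : ℤ) (c e : Fin W), Λ = Finset.Icc a b ×ˢ Finset.Icc c e

/-- The part of `u` that is seen inside `Λ`: the numbers `u_n(x,y)` with `(n,x), (n,y) ∈ Λ`
(padded by zeros for pairs of sites with different first coordinates). -/
def blockOn {W : ℕ} (u : ℤ → Matrix (Fin W) (Fin W) ℝ) (Λ : Finset (Strip W)) :
    Λ → Λ → ℝ := fun i j =>
  if i.1.1 = j.1.1 then u i.1.1 i.1.2 j.1.2 else 0

/-- The standing assumptions on the random potentials `V` and random matrices `U`. -/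
structure IsRandomStripModel {Ω : Type*} [MeasurableSpace Ω] (μ : Measure Ω) {W : ℕ}
    (d : ℕ) (D₀ D₁ : ℝ) (V : Strip W → Ω → ℝ) (U : ℤ → Ω → Matrix (Fin W) (Fin W) ℝ) :
    Prop where
  measurable_V : ∀ i, Measurable (V i)
  measurable_U : ∀ n x y, Measurable (fun ω => U n ω x y)
  /-- The potentials are independent. -/
  indep_V : iIndepFun V μ
  /-- They have a common density, bounded by `D₀`. -/
  density_V : ∃ ρ : ℝ → ℝ, Measurable ρ ∧ (∀ x, 0 ≤ ρ x) ∧ (∀ x, ρ x ≤ D₀) ∧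
    ∀ i, μ.map (V i) = volume.withDensity (fun x => ENNReal.ofReal (ρ x))
  /-- The matrices are symmetric. -/
  symm_U : ∀ n ω, (U n ω).IsSymm
  /-- They vanish at distance more than `d` from the diagonal. -/
  band_U : ∀ n ω (x y : Fin W), (d : ℤ) < |(x : ℤ) - (y : ℤ)| → U n ω x y = 0
  /-- The family of the matrices is independent of the family of the potentials. -/
  indep_V_U : IndepFun (fun ω (i : Strip W) => V i ω)
    (fun ω (p : ℤ × Fin W × Fin W) => U p.1 ω p.2.1 p.2.2) μ
  /-- The parts of the matrices inside pairwise disjoint rectangles are independent (in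
  particular this holds if the matrices are not random). -/
  indep_blocks_U : ∀ (k : ℕ) (R : Fin k → Finset (Strip W)), (∀ i, IsRectangular (R i)) →
    Pairwise (fun i j => Disjoint (R i) (R j)) →
    iIndepFun (fun (i : Fin k) (ω : Ω) => blockOn (fun n => U n ω) (R i)) μ
  tail_V : ∀ i (T : ℝ), 1 ≤ T → μ.real {ω | T ≤ |V i ω|} ≤ D₁ / T
  /-- The norm of a matrix is its operator norm on Euclidean space. -/
  tail_U : ∀ n (T : ℝ), 1 ≤ T →
    μ.real {ω | T ≤ ‖Matrix.toEuclideanCLM (n := Fin W) (𝕜 := ℝ) (U n ω)‖} ≤ D₁ / T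

end

/-! Adding one site `x` to a finite set `T` multiplies the determinant by the Schur complement of
`T` at `x`, which is `V_x` plus a quantity independent of `V_x`. The bounded density controls its
moment of order -1/4. Its moment of order 1/4 is bounded because it involves at most `(2d+3)^2`
entries of the inverse on `T`, and each of these is again a singular function of one or two
potentials. Hence an increment of the log-determinant has an exponential moment at rate 1/4, bounded
uniformly in `T` and `W` (`lintegral_exp_logMinor_insert_le`). By convexity, adding a set `S` costs
an error of order `|S|` in the same sense (`lintegral_exp_logMinor_union_le`).

A rectangle of `N` sites is cut by a separator of at most `d √N` sites into two decoupled rectangles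
of at most `N/2` sites each (`IsRectangular.exists_separator`). Up to the contribution of the
separator, the log-determinant is then a sum of two independent copies of the same problem. A
conjugate pair `p`, `q` splits off the separator. Taking `p = 2^(δ/2)`, the loss `p^2 = 2^δ` in the
variance proxy is exactly the gain of `n ↦ n^(1+δ)` under halving, so the proxy `M N^(1+δ)`
reproduces itself (`lintegral_exp_centered_logMinor_le`). The exponential Chebyshev inequality at `t
= N^(-(1/2+ε))` gives the tail bound. -/

noncomputable section

/-! ### Schur complements, minors and entries of inverses -/

section SchurComplement

variable {ι : Type*} [DecidableEq ι]

/-- The principal minor of a (possibly infinite) matrix with rows and columns in `T`. -/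
def principalMinor (A : Matrix ι ι ℝ) (T : Finset ι) : ℝ :=
  (A.submatrix (Subtype.val : T → ι) Subtype.val).det

/-- The inverse of the principal submatrix with rows and columns in `T`, padded by zeros. -/
def greenFunction (A : Matrix ι ι ℝ) (T : Finset ι) (i j : ι) : ℝ :=
  if h : i ∈ T ∧ j ∈ T then
    (A.submatrix (Subtype.val : T → ι) Subtype.val)⁻¹ ⟨i, h.1⟩ ⟨j, h.2⟩ else 0

/-- The Schur complement of the principal submatrix with rows and columns in `T`. -/
def schurComplement (A : Matrix ι ι ℝ) (T : Finset ι) : Matrix ι ι ℝ :=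
  Matrix.of fun i j => A i j - ∑ y ∈ T, ∑ z ∈ T, A i y * greenFunction A T y z * A z j

theorem principalMinor_empty (A : Matrix ι ι ℝ) : principalMinor A ∅ = 1 := by
  simp [principalMinor]

theorem principalMinor_singleton (A : Matrix ι ι ℝ) (x : ι) :
    principalMinor A {x} = A x x := by
  rw [principalMinor, Matrix.det_eq_elem_of_subsingleton _ ⟨x, Finset.mem_singleton_self x⟩]
  rfl

theorem greenFunction_congr {A B : Matrix ι ι ℝ} {T : Finset ι}
    (h : ∀ i ∈ T, ∀ j ∈ T, A i j = B i j) : greenFunction A T = greenFunction B T := by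
  have : A.submatrix (Subtype.val : T → ι) (Subtype.val : T → ι) =
      B.submatrix (Subtype.val : T → ι) (Subtype.val : T → ι) := by
    ext i j
    exact h i i.2 j j.2
  unfold greenFunction
  rw [this]

/-- If only the entry at `(x, x)` changes, with `x ∉ T`, then the Schur complement of `T`
changes by the same amount. -/
theorem schurComplement_congr {A B : Matrix ι ι ℝ} {T : Finset ι} {x : ι} (hx : x ∉ T)
    (h : ∀ i j, ¬(i = x ∧ j = x) → A i j = B i j) (i j : ι) :
    schurComplement A T i j = A i j - B i j + schurComplement B T i j := by
  have hT : ∀ y ∈ T, y ≠ x := fun y hy hyx => hx (hyx ▸ hy)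
  have hg : greenFunction A T = greenFunction B T :=
    greenFunction_congr fun i hi j _ => h i j fun hh => hT i hi hh.1
  have : ∑ y ∈ T, ∑ z ∈ T, A i y * greenFunction A T y z * A z j =
      ∑ y ∈ T, ∑ z ∈ T, B i y * greenFunction B T y z * B z j := by
    refine Finset.sum_congr rfl fun y hy => Finset.sum_congr rfl fun z hz => ?_
    rw [hg, h i y fun hh => hT y hy hh.2, h z j fun hh => hT z hz hh.1]
  simp only [schurComplement, Matrix.of_apply, this]
  ring

theorem greenFunction_symm {A : Matrix ι ι ℝ} (hA : A.IsSymm) (T : Finset ι) (i j : ι) :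
    greenFunction A T i j = greenFunction A T j i := by
  unfold greenFunction
  by_cases h : i ∈ T ∧ j ∈ T
  · have h' : j ∈ T ∧ i ∈ T := h.symm
    have hs : (A.submatrix (Subtype.val : T → ι) Subtype.val).IsSymm := hA.submatrix _
    have := congrFun (congrFun hs.inv ⟨j, h.2⟩) ⟨i, h.1⟩
    rw [dif_pos h, dif_pos h', ← this, Matrix.transpose_apply]
  · have h' : ¬(j ∈ T ∧ i ∈ T) := fun hh => h hh.symm
    rw [dif_neg h, dif_neg h']

theorem schurComplement_symm {A : Matrix ι ι ℝ} (hA : A.IsSymm) (T : Finset ι) :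
    (schurComplement A T).IsSymm := by
  ext i j
  simp only [Matrix.transpose_apply, schurComplement, Matrix.of_apply]
  rw [Finset.sum_comm, hA.apply i j]
  congr 1
  refine Finset.sum_congr rfl fun y _ => Finset.sum_congr rfl fun z _ => ?_
  rw [greenFunction_symm hA T z y, hA.apply z j, hA.apply i y]
  ring

theorem submatrix_union_eq_fromBlocks (A : Matrix ι ι ℝ) {P T : Finset ι} (h : Disjoint P T) :
    (A.submatrix (Subtype.val : (P ∪ T : Finset ι) → ι) Subtype.val).submatrix
        (Equiv.Finset.union P T h) (Equiv.Finset.union P T h) =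
      Matrix.fromBlocks (A.submatrix (Subtype.val : P → ι) (Subtype.val : P → ι))
        (A.submatrix (Subtype.val : P → ι) (Subtype.val : T → ι))
        (A.submatrix (Subtype.val : T → ι) (Subtype.val : P → ι))
        (A.submatrix (Subtype.val : T → ι) (Subtype.val : T → ι)) := by
  ext (i | i) (j | j) <;> rfl

theorem schurComplement_submatrix (A : Matrix ι ι ℝ) (P T : Finset ι) :
    (schurComplement A T).submatrix (Subtype.val : P → ι) (Subtype.val : P → ι) =
      A.submatrix (Subtype.val : P → ι) (Subtype.val : P → ι) -
        A.submatrix (Subtype.val : P → ι) (Subtype.val : T → ι) *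
        (A.submatrix (Subtype.val : T → ι) (Subtype.val : T → ι))⁻¹ *
        A.submatrix (Subtype.val : T → ι) (Subtype.val : P → ι) := by
  ext i j
  simp only [Matrix.submatrix_apply, schurComplement, Matrix.of_apply, Matrix.sub_apply,
    Matrix.mul_apply, Finset.sum_mul]
  congr 1
  rw [Finset.sum_comm, ← Finset.sum_coe_sort T]
  refine Finset.sum_congr rfl fun z _ => ?_
  rw [← Finset.sum_coe_sort T]
  refine Finset.sum_congr rfl fun y _ => ?_
  rw [greenFunction, dif_pos ⟨y.2, z.2⟩]

theorem principalMinor_union (A : Matrix ι ι ℝ) {P T : Finset ι} (h : Disjoint P T)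
    (hT : principalMinor A T ≠ 0) :
    principalMinor A (P ∪ T) =
      principalMinor A T * principalMinor (schurComplement A T) P := by
  have hu : IsUnit (A.submatrix (Subtype.val : T → ι) (Subtype.val : T → ι)) :=
    (Matrix.isUnit_iff_isUnit_det _).2 (isUnit_iff_ne_zero.2 hT)
  let _ := hu.invertible
  unfold principalMinor
  rw [← Matrix.det_submatrix_equiv_self (Equiv.Finset.union P T h),
    submatrix_union_eq_fromBlocks A h, Matrix.det_fromBlocks₂₂, schurComplement_submatrix,
    Matrix.invOf_eq_nonsing_inv]

/-- The corner of a block inverse is the inverse of the Schur complement. With `P` of one or two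
sites, an entry of a large inverse becomes an explicit function of a matrix of size 1 or 2. -/
theorem greenFunction_union (A : Matrix ι ι ℝ) {P T : Finset ι} (h : Disjoint P T)
    (hT : principalMinor A T ≠ 0) (hPT : principalMinor A (P ∪ T) ≠ 0) {i j : ι}
    (hi : i ∈ P) (hj : j ∈ P) :
    greenFunction A (P ∪ T) i j = greenFunction (schurComplement A T) P i j := by
  have hP : principalMinor (schurComplement A T) P ≠ 0 := by
    intro h0
    rw [principalMinor_union A h hT, h0, mul_zero] at hPT
    exact hPT rfl
  have hu : IsUnit (A.submatrix (Subtype.val : T → ι) (Subtype.val : T → ι)) :=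
    (Matrix.isUnit_iff_isUnit_det _).2 (isUnit_iff_ne_zero.2 hT)
  let _ := hu.invertible
  have hu2 : IsUnit ((schurComplement A T).submatrix (Subtype.val : P → ι) Subtype.val) :=
    (Matrix.isUnit_iff_isUnit_det _).2 (isUnit_iff_ne_zero.2 hP)
  rw [schurComplement_submatrix, ← Matrix.invOf_eq_nonsing_inv] at hu2
  let _ := hu2.invertible
  have hu3 : IsUnit (A.submatrix (Subtype.val : (P ∪ T : Finset ι) → ι) Subtype.val) :=
    (Matrix.isUnit_iff_isUnit_det _).2 (isUnit_iff_ne_zero.2 hPT)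
  have hu4 := hu3.map (Matrix.reindexRingEquiv ℝ (Equiv.Finset.union P T h).symm)
  have hu4 : IsUnit ((A.submatrix (Subtype.val : (P ∪ T : Finset ι) → ι) Subtype.val).submatrix
        (Equiv.Finset.union P T h) (Equiv.Finset.union P T h)) := hu4
  rw [submatrix_union_eq_fromBlocks A h] at hu4
  let _ := hu4.invertible
  have key := Matrix.invOf_fromBlocks₂₂_eq (A.submatrix (Subtype.val : P → ι) (Subtype.val : P → ι))
        (A.submatrix (Subtype.val : P → ι) (Subtype.val : T → ι))
        (A.submatrix (Subtype.val : T → ι) (Subtype.val : P → ι))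
        (A.submatrix (Subtype.val : T → ι) (Subtype.val : T → ι))
  rw [Matrix.invOf_eq_nonsing_inv (Matrix.fromBlocks _ _ _ _),
    ← submatrix_union_eq_fromBlocks A h, Matrix.inv_submatrix_equiv] at key
  have key2 := congrFun (congrFun key (Sum.inl ⟨i, hi⟩)) (Sum.inl ⟨j, hj⟩)
  rw [Matrix.fromBlocks_apply₁₁, Matrix.invOf_eq_nonsing_inv (_ - _), Matrix.invOf_eq_nonsing_inv,
    ← schurComplement_submatrix] at key2
  rw [greenFunction, dif_pos ⟨Finset.mem_union_left _ hi, Finset.mem_union_left _ hj⟩,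
    greenFunction, dif_pos ⟨hi, hj⟩, ← key2]
  rfl

theorem principalMinor_insert (A : Matrix ι ι ℝ) {x : ι} {T : Finset ι} (hx : x ∉ T)
    (hT : principalMinor A T ≠ 0) :
    principalMinor A (insert x T) = principalMinor A T * schurComplement A T x x := by
  rw [Finset.insert_eq, principalMinor_union A (Finset.disjoint_singleton_left.2 hx) hT,
    principalMinor_singleton]

theorem greenFunction_singleton (A : Matrix ι ι ℝ) (x : ι) :
    greenFunction A {x} x x = (A x x)⁻¹ := by
  have h : x ∈ ({x} : Finset ι) ∧ x ∈ ({x} : Finset ι) := by simp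
  rw [greenFunction, dif_pos h, Matrix.inv_def,
    Matrix.det_eq_elem_of_subsingleton _ ⟨x, Finset.mem_singleton_self x⟩]
  simp [Matrix.adjugate_subsingleton]

theorem greenFunction_insert_self (A : Matrix ι ι ℝ) {x : ι} {T : Finset ι} (hx : x ∉ T)
    (hT : principalMinor A T ≠ 0) (hxT : principalMinor A (insert x T) ≠ 0) :
    greenFunction A (insert x T) x x = (schurComplement A T x x)⁻¹ := by
  rw [Finset.insert_eq] at hxT ⊢
  rw [greenFunction_union A (Finset.disjoint_singleton_left.2 hx) hT hxT
    (Finset.mem_singleton_self x) (Finset.mem_singleton_self x), greenFunction_singleton]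

/-- The bijection of `Fin 2` with a pair. -/
def finTwoEquivPair {y z : ι} (h : y ≠ z) : Fin 2 ≃ ({y, z} : Finset ι) :=
  Equiv.ofBijective ![⟨y, by simp⟩, ⟨z, by simp⟩] (by
    constructor
    · intro i j
      fin_cases i <;> fin_cases j <;> simp [h, h.symm]
    · rintro ⟨w, hw⟩
      rcases Finset.mem_insert.1 hw with rfl | hw'
      · exact ⟨0, rfl⟩
      · obtain rfl := Finset.mem_singleton.1 hw'
        exact ⟨1, rfl⟩)

theorem greenFunction_pair (A : Matrix ι ι ℝ) {y z : ι} (h : y ≠ z) :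
    greenFunction A {y, z} y z = - A y z / (A y y * A z z - A y z * A z y) := by
  have hm : y ∈ ({y, z} : Finset ι) ∧ z ∈ ({y, z} : Finset ι) := by simp
  have h1 : (A.submatrix (Subtype.val : ({y, z} : Finset ι) → ι) Subtype.val)⁻¹ ⟨y, hm.1⟩ ⟨z, hm.2⟩
      = ((A.submatrix (Subtype.val : ({y, z} : Finset ι) → ι) Subtype.val).submatrix
        (finTwoEquivPair h) (finTwoEquivPair h))⁻¹ 0 1 := by
    rw [Matrix.inv_submatrix_equiv]
    rfl
  have h2 : ((A.submatrix (Subtype.val : ({y, z} : Finset ι) → ι) Subtype.val).submatrix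
        (finTwoEquivPair h) (finTwoEquivPair h)) = !![A y y, A y z; A z y, A z z] := by
    ext i j
    fin_cases i <;> fin_cases j <;> rfl
  rw [greenFunction, dif_pos hm, h1, h2, Matrix.inv_def, Matrix.adjugate_fin_two,
    Matrix.det_fin_two]
  simp [div_eq_inv_mul]

/-- An off-diagonal entry of the inverse is controlled by inverses of quantities which are
affine functions of a diagonal entry. -/
theorem abs_div_det_two_le (x y b : ℝ) :
    |b / (x * y - b * b)| ≤
      |(x - b * b / y)⁻¹| + |(y - b * b / x)⁻¹| + |(x - b)⁻¹| + |(x + b)⁻¹| := by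
  rcases eq_or_ne (x * y - b * b) 0 with h0 | h0
  · rw [h0, div_zero, abs_zero]; positivity
  have n1 := abs_nonneg (x - b * b / y)⁻¹
  have n2 := abs_nonneg (y - b * b / x)⁻¹
  have n3 := abs_nonneg (x - b)⁻¹
  have n4 := abs_nonneg (x + b)⁻¹
  rcases eq_or_ne b 0 with rfl | hb
  · simp; positivity
  have hb' : 0 < |b| := abs_pos.2 hb
  -- Here `b` may be replaced by the larger `y` in the numerator, and `y / (x y - b²)` is the
  -- inverse of `x - b² / y`. The case `|b| ≤ |x|` is symmetric.
  by_cases hy : |b| ≤ |y|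
  · have hy0 : y ≠ 0 := abs_pos.1 (hb'.trans_le hy)
    have e : (x - b * b / y)⁻¹ = y / (x * y - b * b) := by
      rw [eq_div_iff h0]
      have : x * y - b * b = (x - b * b / y) * y := by field_simp
      have h3 : x - b * b / y ≠ 0 := by
        intro h4; rw [this, h4, zero_mul] at h0; exact h0 rfl
      rw [this, inv_mul_cancel_left₀ h3]
    have : |b / (x * y - b * b)| ≤ |(x - b * b / y)⁻¹| := by
      rw [e, abs_div, abs_div]; gcongr
    linarith
  by_cases hx : |b| ≤ |x|
  · have hx0 : x ≠ 0 := abs_pos.1 (hb'.trans_le hx)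
    have e : (y - b * b / x)⁻¹ = x / (x * y - b * b) := by
      rw [eq_div_iff h0]
      have : x * y - b * b = (y - b * b / x) * x := by field_simp
      have h3 : y - b * b / x ≠ 0 := by
        intro h4; rw [this, h4, zero_mul] at h0; exact h0 rfl
      rw [this, inv_mul_cancel_left₀ h3]
    have : |b / (x * y - b * b)| ≤ |(y - b * b / x)⁻¹| := by
      rw [e, abs_div, abs_div]; gcongr
    linarith
  -- With both diagonal entries smaller than `|b|`, the determinant is at least `|b| (|b| - |x|)`,
  -- and `|b| - |x|` is one of `|x - b|`, `|x + b|`.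
  · push Not at hx hy
    have hd : |b| * (|b| - |x|) ≤ |x * y - b * b| := by
      have h1 : |b * b| - |x * y| ≤ |x * y - b * b| := by
        rw [abs_sub_comm]; exact abs_sub_abs_le_abs_sub _ _
      rw [abs_mul, abs_mul] at h1
      nlinarith [abs_nonneg x, abs_nonneg y]
    have hpos : 0 < |b| - |x| := by linarith
    have h5 : |b / (x * y - b * b)| ≤ (|b| - |x|)⁻¹ := by
      rw [abs_div, div_le_iff₀ (abs_pos.2 h0), ← div_eq_inv_mul, le_div_iff₀ hpos]
      exact hd
    have h6 : (|b| - |x|)⁻¹ ≤ |(x - b)⁻¹| + |(x + b)⁻¹| := by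
      rcases abs_cases b with ⟨e1, _⟩ | ⟨e1, _⟩ <;> rcases abs_cases x with ⟨e2, _⟩ | ⟨e2, _⟩ <;>
        rw [e1, e2] at hpos ⊢
      · rw [abs_inv, abs_inv, abs_of_neg (show x - b < 0 by linarith),
          show -(x - b) = b - x by ring]
        exact le_add_of_nonneg_right (by positivity)
      · rw [abs_inv, abs_inv, abs_of_pos (show 0 < x + b by linarith),
          show b - -x = x + b by ring]
        exact le_add_of_nonneg_left (by positivity)
      · rw [abs_inv, abs_inv, abs_of_neg (show x + b < 0 by linarith),
          show -(x + b) = -b - x by ring]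
        exact le_add_of_nonneg_left (by positivity)
      · rw [abs_inv, abs_inv, abs_of_pos (show 0 < x - b by linarith),
          show -b - -x = x - b by ring]
        exact le_add_of_nonneg_right (by positivity)
    linarith

/-- If the index set splits into two decoupled parts, then the minor is the product. -/
theorem principalMinor_union_of_decoupled (A : Matrix ι ι ℝ) {P T : Finset ι} (h : Disjoint P T)
    (h0 : ∀ i ∈ P, ∀ j ∈ T, A i j = 0) :
    principalMinor A (P ∪ T) = principalMinor A P * principalMinor A T := by
  have hz : A.submatrix (Subtype.val : P → ι) (Subtype.val : T → ι) = 0 := by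
    ext i j
    exact h0 i i.2 j j.2
  unfold principalMinor
  rw [← Matrix.det_submatrix_equiv_self (Equiv.Finset.union P T h),
    submatrix_union_eq_fromBlocks A h, hz, Matrix.det_fromBlocks_zero₁₂]

end SchurComplement

/-! ### Measurability of minors, inverses and Schur complements -/

section Measurability

variable {ι α : Type*} [DecidableEq ι] [MeasurableSpace α]

theorem measurable_matrix_det {n : Type*} [DecidableEq n] [Fintype n] {M : α → Matrix n n ℝ}
    (hM : ∀ i j, Measurable fun a => M a i j) : Measurable fun a => (M a).det := by
  simp only [Matrix.det_apply]
  exact Finset.measurable_sum _ fun σ _ =>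
    (Finset.measurable_prod _ fun i _ => hM _ _).const_smul _

theorem measurable_matrix_inv {n : Type*} [DecidableEq n] [Fintype n] {M : α → Matrix n n ℝ}
    (hM : ∀ i j, Measurable fun a => M a i j) (i j : n) : Measurable fun a => (M a)⁻¹ i j := by
  simp only [Matrix.inv_def, Matrix.smul_apply, Ring.inverse_eq_inv', smul_eq_mul,
    Matrix.adjugate_apply]
  refine (measurable_matrix_det hM).inv.mul (measurable_matrix_det fun k l => ?_)
  by_cases h : k = j
  · subst h
    simp only [Matrix.updateRow_self]
    exact measurable_const
  · simp only [Matrix.updateRow_ne h]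
    exact hM k l

variable {M : α → Matrix ι ι ℝ}

theorem measurable_principalMinor (hM : ∀ i j, Measurable fun a => M a i j) (T : Finset ι) :
    Measurable fun a => principalMinor (M a) T :=
  measurable_matrix_det fun i j => hM i j

theorem measurable_greenFunction (hM : ∀ i j, Measurable fun a => M a i j) (T : Finset ι)
    (i j : ι) : Measurable fun a => greenFunction (M a) T i j := by
  unfold greenFunction
  by_cases h : i ∈ T ∧ j ∈ T
  · simp only [dif_pos h]
    exact measurable_matrix_inv
      (M := fun a => (M a).submatrix (Subtype.val : T → ι) (Subtype.val : T → ι))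
      (fun k l => hM k l) _ _
  · simp only [dif_neg h]
    exact measurable_const

theorem measurable_schurComplement (hM : ∀ i j, Measurable fun a => M a i j) (T : Finset ι)
    (i j : ι) : Measurable fun a => schurComplement (M a) T i j := by
  simp only [schurComplement, Matrix.of_apply]
  exact (hM i j).sub (Finset.measurable_sum _ fun y _ => Finset.measurable_sum _ fun z _ =>
    ((hM i y).mul (measurable_greenFunction hM T y z)).mul (hM z j))

end Measurability

/-! ### Regrouping independent random variables -/

section Independence

variable {Ω : Type*} [MeasurableSpace Ω] {μ : Measure Ω} [IsProbabilityMeasure μ]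

/-- If `X` and `Y` are independent, and `Z` is independent of the pair, then `X` is independent of
the pair `(Y, Z)`. -/
theorem indepFun_prodMk_right {α β γ : Type*} [MeasurableSpace α] [MeasurableSpace β]
    [MeasurableSpace γ] {X : Ω → α} {Y : Ω → β} {Z : Ω → γ} (hX : Measurable X)
    (hY : Measurable Y) (hZ : Measurable Z) (hXY : IndepFun X Y μ)
    (hXYZ : IndepFun (fun ω => (X ω, Y ω)) Z μ) : IndepFun X (fun ω => (Y ω, Z ω)) μ := by
  have := Measure.isProbabilityMeasure_map (μ := μ) hX.aemeasurable
  have := Measure.isProbabilityMeasure_map (μ := μ) hY.aemeasurable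
  have := Measure.isProbabilityMeasure_map (μ := μ) hZ.aemeasurable
  have hYZ : IndepFun Y Z μ := hXYZ.comp measurable_snd measurable_id
  rw [indepFun_iff_map_prod_eq_prod_map_map hX.aemeasurable (hY.prodMk hZ).aemeasurable,
    hYZ.map_prod_eq_prod_map_map hY.aemeasurable hZ.aemeasurable, ← Measure.prodAssoc_prod,
    ← hXY.map_prod_eq_prod_map_map hX.aemeasurable hY.aemeasurable,
    ← hXYZ.map_prod_eq_prod_map_map (hX.prodMk hY).aemeasurable hZ.aemeasurable,
    Measure.map_map MeasurableEquiv.prodAssoc.measurable ((hX.prodMk hY).prodMk hZ)]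
  rfl

/-- Two independent pairs of independent random variables can be regrouped. -/
theorem indepFun_prodMk_prodMk_comm {α β γ δ : Type*} [MeasurableSpace α] [MeasurableSpace β]
    [MeasurableSpace γ] [MeasurableSpace δ] {X₁ : Ω → α} {X₂ : Ω → β} {Y₁ : Ω → γ} {Y₂ : Ω → δ}
    (hX₁ : Measurable X₁) (hX₂ : Measurable X₂) (hY₁ : Measurable Y₁) (hY₂ : Measurable Y₂)
    (hX : IndepFun X₁ X₂ μ) (hY : IndepFun Y₁ Y₂ μ)
    (hXY : IndepFun (fun ω => (X₁ ω, X₂ ω)) (fun ω => (Y₁ ω, Y₂ ω)) μ) :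
    IndepFun (fun ω => (X₁ ω, Y₁ ω)) (fun ω => (X₂ ω, Y₂ ω)) μ := by
  have h1 : IndepFun X₁ (fun ω => (X₂ ω, (Y₁ ω, Y₂ ω))) μ :=
    indepFun_prodMk_right hX₁ hX₂ (hY₁.prodMk hY₂) hX hXY
  have h2 : IndepFun X₂ (fun ω => (Y₂ ω, Y₁ ω)) μ :=
    hXY.comp measurable_snd (measurable_snd.prodMk measurable_fst)
  have h3 : IndepFun (fun ω => (X₂ ω, Y₂ ω)) Y₁ μ :=
    (indepFun_prodMk_right hY₁ hY₂ hX₂ hY (h2.symm.comp measurable_swap measurable_id)).symm.comp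
      measurable_swap measurable_id
  refine (indepFun_prodMk_right (hX₂.prodMk hY₂) hY₁ hX₁ h3 ?_).symm.comp measurable_swap
    measurable_id
  exact h1.symm.comp (φ := fun p : β × (γ × δ) => ((p.1, p.2.2), p.2.1)) (by fun_prop)
    measurable_id

end Independence

/-! ### Negative fractional moments from a bounded density -/

section SingularMoments

/-- The singular integral that bounds the negative fractional moments. -/
def singularIntegral : ENNReal := ∫⁻ x in Set.Ioo (-1 : ℝ) 1, (‖x‖ₑ ^ (1 / 4 : ℝ))⁻¹

theorem singularIntegral_ne_top : singularIntegral ≠ ⊤ := by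
  have h1 : IntegrableOn (fun x : ℝ => x ^ (-(1 / 4) : ℝ)) (Set.Ioc 0 1) := by
    have := intervalIntegral.intervalIntegrable_rpow' (a := 0) (b := 1)
      (show (-1 : ℝ) < -(1 / 4) by norm_num)
    rwa [intervalIntegrable_iff_integrableOn_Ioc_of_le zero_le_one] at this
  have e2 : ∀ x : ℝ, x ∈ Set.Ioc (0 : ℝ) 1 →
      (‖x‖ₑ ^ (1 / 4 : ℝ))⁻¹ = ‖x ^ (-(1 / 4) : ℝ)‖ₑ := by
    intro x hx
    rw [Real.enorm_of_nonneg hx.1.le, Real.enorm_of_nonneg (Real.rpow_nonneg hx.1.le _),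
      ← ENNReal.ofReal_rpow_of_pos hx.1, ENNReal.rpow_neg]
  have h2 : ∫⁻ x in Set.Ioc (0 : ℝ) 1, (‖x‖ₑ ^ (1 / 4 : ℝ))⁻¹ < ⊤ := by
    rw [setLIntegral_congr_fun measurableSet_Ioc e2]
    exact h1.2
  have h3 : ∫⁻ x in Set.Ico (-1 : ℝ) 0, (‖x‖ₑ ^ (1 / 4 : ℝ))⁻¹ < ⊤ := by
    have := (Measure.measurePreserving_neg (volume : Measure ℝ)).setLIntegral_comp_preimage_emb
      (MeasurableEquiv.neg ℝ).measurableEmbedding (fun x : ℝ => (‖x‖ₑ ^ (1 / 4 : ℝ))⁻¹)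
      (Set.Ioc 0 1)
    simp only [enorm_neg, Set.neg_preimage, Set.neg_Ioc, neg_zero] at this
    rw [this]
    exact h2
  have hsub : Set.Ioo (-1 : ℝ) 1 ⊆ Set.Ico (-1 : ℝ) 0 ∪ {0} ∪ Set.Ioc (0 : ℝ) 1 := by
    rintro x ⟨hx1, hx2⟩
    rcases lt_trichotomy x 0 with hx | hx | hx
    · exact Or.inl (Or.inl ⟨hx1.le, hx⟩)
    · exact Or.inl (Or.inr hx)
    · exact Or.inr ⟨hx, hx2.le⟩
  refine ne_of_lt (lt_of_le_of_lt (lintegral_mono_set hsub) ?_)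
  refine lt_of_le_of_lt (lintegral_union_le _ _ _) (ENNReal.add_lt_top.2 ⟨?_, h2⟩)
  refine lt_of_le_of_lt (lintegral_union_le _ _ _) (ENNReal.add_lt_top.2 ⟨h3, ?_⟩)
  simp

/-- The bound for the negative fractional moments of random variables with density at
most `D`. -/
def singularMomentBound (D : ℝ) : ENNReal := 1 + ENNReal.ofReal D * singularIntegral

theorem singularMomentBound_ne_top (D : ℝ) : singularMomentBound D ≠ ⊤ :=
  ENNReal.add_ne_top.2 ⟨ENNReal.one_ne_top,
    ENNReal.mul_ne_top ENNReal.ofReal_ne_top singularIntegral_ne_top⟩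

/-- Where `|x + c| ≥ 1` the integrand is at most 1. On the rest the density is replaced by `D`, and
translation invariance of Lebesgue measure makes the bound uniform in the shift `c`. -/
theorem lintegral_inv_enorm_add_rpow_le {D : ℝ} {ρ : ℝ → ℝ} (hρ : Measurable ρ)
    (hD : ∀ x, ρ x ≤ D) {ν : Measure ℝ} [IsProbabilityMeasure ν]
    (hν : ν = volume.withDensity fun x => ENNReal.ofReal (ρ x)) (c : ℝ) :
    ∫⁻ x, (‖x + c‖ₑ ^ (1 / 4 : ℝ))⁻¹ ∂ν ≤ singularMomentBound D := by
  set g : ℝ → ENNReal := fun x => (‖x‖ₑ ^ (1 / 4 : ℝ))⁻¹ with hg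
  have hgm : Measurable g := by fun_prop
  have h1 : ∀ x, g x ≤ 1 + (Set.Ioo (-1 : ℝ) 1).indicator g x := by
    intro x
    by_cases hx : x ∈ Set.Ioo (-1 : ℝ) 1
    · rw [Set.indicator_of_mem hx]
      exact le_add_self
    · rw [Set.indicator_of_notMem hx, add_zero, hg, ENNReal.inv_le_one]
      refine ENNReal.one_le_rpow ?_ (by norm_num)
      rw [← ofReal_norm, ENNReal.one_le_ofReal, Real.norm_eq_abs]
      by_contra! hlt
      exact hx (abs_lt.1 hlt)
  have hmi : Measurable ((Set.Ioo (-1 : ℝ) 1).indicator g) := hgm.indicator measurableSet_Ioo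
  have hmc : Measurable fun x => (Set.Ioo (-1 : ℝ) 1).indicator g (x + c) :=
    hmi.comp (measurable_id.add_const c)
  calc ∫⁻ x, g (x + c) ∂ν ≤ ∫⁻ x, 1 + (Set.Ioo (-1 : ℝ) 1).indicator g (x + c) ∂ν :=
        lintegral_mono fun x => h1 _
    _ = 1 + ∫⁻ x, (Set.Ioo (-1 : ℝ) 1).indicator g (x + c) ∂ν := by
        rw [lintegral_add_left measurable_const]; simp
    _ ≤ 1 + ∫⁻ x, ENNReal.ofReal D * (Set.Ioo (-1 : ℝ) 1).indicator g (x + c) := by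
        gcongr 1 + ?_
        rw [hν, lintegral_withDensity_eq_lintegral_mul _ hρ.ennreal_ofReal hmc]
        refine lintegral_mono fun x => ?_
        exact mul_le_mul_left (ENNReal.ofReal_le_ofReal (hD x)) _
    _ = singularMomentBound D := by
        rw [lintegral_const_mul _ hmc,
          lintegral_add_right_eq_self (fun x => (Set.Ioo (-1 : ℝ) 1).indicator g x) c,
          lintegral_indicator measurableSet_Ioo]
        rfl

end SingularMoments

/-! ### Realizations of the model and the dependence on one potential -/

section State

variable {W : ℕ}

/-- One realization of the potentials and of the entries of the matrices. -/
abbrev StripState (W : ℕ) : Type := (Strip W → ℝ) × (ℤ × Fin W × Fin W → ℝ)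

/-- The matrix of `H - E` for a given realization. -/
def stripMatrix (E : ℝ) (σ : StripState W) : Matrix (Strip W) (Strip W) ℝ :=
  Matrix.of fun i j =>
    (if i.2 = j.2 ∧ |i.1 - j.1| = 1 then -1 else 0) + (if i = j then σ.1 i else 0) -
      (if i.1 = j.1 then σ.2 (i.1, i.2, j.2) else 0) - (if i = j then E else 0)

/-- The realization in which the potential at `x` is replaced by zero. -/
def resetSite (x : Strip W) (σ : StripState W) : StripState W := (Function.update σ.1 x 0, σ.2)

/-- The realization of a random strip model at `ω`. -/
def sampleState {Ω : Type*} (V : Strip W → Ω → ℝ) (U : ℤ → Ω → Matrix (Fin W) (Fin W) ℝ)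
    (ω : Ω) : StripState W :=
  (fun i => V i ω, fun p => U p.1 ω p.2.1 p.2.2)

theorem dirichletDet_eq_principalMinor {Ω : Type*} (V : Strip W → Ω → ℝ)
    (U : ℤ → Ω → Matrix (Fin W) (Fin W) ℝ) (ω : Ω) (E : ℝ) (Λ : Finset (Strip W)) :
    dirichletDet (fun i => V i ω) (fun n => U n ω) E Λ =
      principalMinor (stripMatrix E (sampleState V U ω)) Λ := by
  unfold dirichletDet principalMinor
  congr 1
  ext i j
  simp only [Matrix.sub_apply, dirichletRestriction_apply, Matrix.smul_apply, Matrix.one_apply,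
    smul_eq_mul, mul_ite, mul_one, mul_zero, Matrix.submatrix_apply, stripMatrix, Matrix.of_apply,
    sampleState, Subtype.ext_iff]

theorem measurable_stripMatrix (E : ℝ) (i j : Strip W) :
    Measurable fun σ : StripState W => stripMatrix E σ i j := by
  simp only [stripMatrix, Matrix.of_apply]
  have h1 : Measurable fun σ : StripState W => σ.1 i := by fun_prop
  have h2 : Measurable fun σ : StripState W => σ.2 (i.1, i.2, j.2) := by fun_prop
  refine Measurable.sub (Measurable.sub (measurable_const.add ?_) ?_) measurable_const
  · split_ifs
    exacts [h1, measurable_const]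
  · split_ifs
    exacts [h2, measurable_const]

theorem measurable_resetSite (x : Strip W) : Measurable (resetSite (W := W) x) := by
  refine Measurable.prodMk ?_ measurable_snd
  refine measurable_pi_lambda _ fun i => ?_
  by_cases hi : i = x
  · subst hi
    simp only [Function.update_self]
    exact measurable_const
  · simp only [Function.update_of_ne hi]
    fun_prop

theorem stripMatrix_resetSite_of_ne (E : ℝ) (x : Strip W) (σ : StripState W) (i j : Strip W)
    (h : ¬(i = x ∧ j = x)) : stripMatrix E σ i j = stripMatrix E (resetSite x σ) i j := by
  simp only [stripMatrix, Matrix.of_apply, resetSite]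
  by_cases hij : i = j
  · subst hij
    have : i ≠ x := fun hi => h ⟨hi, hi⟩
    simp [this]
  · simp [hij]

theorem stripMatrix_resetSite_self (E : ℝ) (x : Strip W) (σ : StripState W) :
    stripMatrix E σ x x = σ.1 x + stripMatrix E (resetSite x σ) x x := by
  simp only [stripMatrix, Matrix.of_apply, resetSite]
  simp
  ring

/-- Since `x ∉ T`, the inverse on `T` does not see the potential at `x`, which therefore enters
additively with coefficient one. Every averaging argument rests on this. -/
theorem schurComplement_resetSite_self (E : ℝ) {x : Strip W} {T : Finset (Strip W)} (hx : x ∉ T)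
    (σ : StripState W) :
    schurComplement (stripMatrix E σ) T x x =
      σ.1 x + schurComplement (stripMatrix E (resetSite x σ)) T x x := by
  rw [schurComplement_congr hx (stripMatrix_resetSite_of_ne E x σ), stripMatrix_resetSite_self]
  ring

theorem schurComplement_resetSite_of_ne (E : ℝ) {x : Strip W} {T : Finset (Strip W)} (hx : x ∉ T)
    (σ : StripState W) {i j : Strip W} (h : ¬(i = x ∧ j = x)) :
    schurComplement (stripMatrix E (resetSite x σ)) T i j =
      schurComplement (stripMatrix E σ) T i j := by
  rw [schurComplement_congr hx (stripMatrix_resetSite_of_ne E x σ),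
    stripMatrix_resetSite_of_ne E x σ i j h]
  ring

end State

/-! ### Averaging over one potential -/

/-- Strict at `a = 0`: the real inverse of zero is zero, the extended one is `⊤`. -/
theorem enorm_inv_le {a : ℝ} : ‖a⁻¹‖ₑ ≤ ‖a‖ₑ⁻¹ := by
  rcases eq_or_ne a 0 with rfl | h
  · simp
  · rw [enorm_inv h]

theorem enorm_div_det_two_rpow_le (x y b : ℝ) :
    ‖-b / (x * y - b * b)‖ₑ ^ (1 / 4 : ℝ) ≤
      (‖x - b * b / y‖ₑ ^ (1 / 4 : ℝ))⁻¹ + (‖y - b * b / x‖ₑ ^ (1 / 4 : ℝ))⁻¹ +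
        (‖x - b‖ₑ ^ (1 / 4 : ℝ))⁻¹ + (‖x + b‖ₑ ^ (1 / 4 : ℝ))⁻¹ := by
  have h0 := abs_div_det_two_le x y b
  have h1 : ‖-b / (x * y - b * b)‖ₑ ≤ ‖(x - b * b / y)⁻¹‖ₑ + ‖(y - b * b / x)⁻¹‖ₑ +
      ‖(x - b)⁻¹‖ₑ + ‖(x + b)⁻¹‖ₑ := by
    simp only [← ofReal_norm, Real.norm_eq_abs]
    rw [← ENNReal.ofReal_add (by positivity) (by positivity),
      ← ENNReal.ofReal_add (by positivity) (by positivity),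
      ← ENNReal.ofReal_add (by positivity) (by positivity), neg_div, abs_neg]
    exact ENNReal.ofReal_le_ofReal h0
  have h2 : ∀ a b : ENNReal, (a + b) ^ (1 / 4 : ℝ) ≤ a ^ (1 / 4 : ℝ) + b ^ (1 / 4 : ℝ) :=
    fun a b => ENNReal.rpow_add_le_add_rpow a b (by norm_num) (by norm_num)
  have h3 : ∀ a : ℝ, ‖a⁻¹‖ₑ ^ (1 / 4 : ℝ) ≤ (‖a‖ₑ ^ (1 / 4 : ℝ))⁻¹ := fun a => by
    rw [← ENNReal.inv_rpow]
    exact ENNReal.rpow_le_rpow enorm_inv_le (by norm_num)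
  refine (ENNReal.rpow_le_rpow h1 (by norm_num)).trans ?_
  refine (h2 _ _).trans (add_le_add ?_ (h3 _))
  refine (h2 _ _).trans (add_le_add ?_ (h3 _))
  exact (h2 _ _).trans (add_le_add (h3 _) (h3 _))

namespace IsRandomStripModel

variable {Ω : Type*} [MeasurableSpace Ω] {μ : Measure Ω} {W d : ℕ}
  {D₀ D₁ : ℝ} {V : Strip W → Ω → ℝ} {U : ℤ → Ω → Matrix (Fin W) (Fin W) ℝ}

theorem measurable_sampleState (h : IsRandomStripModel μ d D₀ D₁ V U) :
    Measurable (sampleState V U) :=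
  Measurable.prodMk (measurable_pi_lambda _ fun i => h.measurable_V i)
    (measurable_pi_lambda _ fun p => h.measurable_U p.1 p.2.1 p.2.2)

theorem isSymm_stripMatrix (h : IsRandomStripModel μ d D₀ D₁ V U) (E : ℝ) (ω : Ω) :
    (stripMatrix E (sampleState V U ω)).IsSymm := by
  ext i j
  simp only [Matrix.transpose_apply, stripMatrix, Matrix.of_apply, sampleState]
  rw [abs_sub_comm]
  by_cases hij : i = j
  · subst hij; rfl
  · have hji : j ≠ i := fun hh => hij hh.symm
    by_cases h1 : i.1 = j.1
    · have := (h.symm_U i.1 ω).apply j.2 i.2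
      simp [hij, hji, h1, eq_comm (a := j.2)]
      rw [← h1, this]
    · have h1' : j.1 ≠ i.1 := fun hh => h1 hh.symm
      simp [hij, hji, h1, h1', eq_comm (a := j.2)]

variable [IsProbabilityMeasure μ]

/-- The reset state is a measurable function of the other potentials and of the matrices, and this
pair is independent of `V x`. -/
theorem indepFun_potential_resetSite (h : IsRandomStripModel μ d D₀ D₁ V U) (x : Strip W) :
    IndepFun (V x) (fun ω => resetSite x (sampleState V U ω)) μ := by
  have h1 : IndepFun (V x) (fun ω (i : {i : Strip W // i ≠ x}) => V i ω) μ := by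
    refine IndepFun.indepFun_process (h.measurable_V x) (fun i => h.measurable_V i) fun I => ?_
    have hd : Disjoint ({x} : Finset (Strip W)) (I.map (Function.Embedding.subtype _)) := by
      rw [Finset.disjoint_singleton_left]
      simp
    have := h.indep_V.indepFun_finset _ _ hd h.measurable_V
    have hφ : Measurable fun f : ({x} : Finset (Strip W)) → ℝ =>
        f ⟨x, Finset.mem_singleton_self x⟩ := measurable_pi_apply _
    refine this.comp (ψ := fun f (i : I) => f ⟨i.1.1, Finset.mem_map_of_mem _ i.2⟩) hφ ?_
    exact measurable_pi_lambda _ fun i => measurable_pi_apply _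
  have h2 : IndepFun (fun ω => (V x ω, fun (i : {i : Strip W // i ≠ x}) => V i ω))
      (fun ω (p : ℤ × Fin W × Fin W) => U p.1 ω p.2.1 p.2.2) μ :=
    h.indep_V_U.comp (φ := fun v => (v x, fun (i : {i : Strip W // i ≠ x}) => v i))
      (by fun_prop) measurable_id
  have h3 := indepFun_prodMk_right (h.measurable_V x)
    (measurable_pi_lambda _ fun i : {i : Strip W // i ≠ x} => h.measurable_V i)
    (measurable_pi_lambda _ fun p : ℤ × Fin W × Fin W => h.measurable_U p.1 p.2.1 p.2.2) h1 h2
  have h4 : (fun ω => resetSite x (sampleState V U ω)) =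
      (fun q : ({i : Strip W // i ≠ x} → ℝ) × (ℤ × Fin W × Fin W → ℝ) =>
        ((fun i => if hi : i ≠ x then q.1 ⟨i, hi⟩ else 0, q.2) : StripState W)) ∘
      (fun ω => (fun (i : {i : Strip W // i ≠ x}) => V i ω,
        fun (p : ℤ × Fin W × Fin W) => U p.1 ω p.2.1 p.2.2)) := by
    funext ω
    refine Prod.ext (funext fun i => ?_) rfl
    by_cases hi : i = x
    · subst hi; simp [resetSite]
    · simp [resetSite, sampleState, hi]
  rw [h4]
  refine h3.comp measurable_id (Measurable.prodMk (measurable_pi_lambda _ fun i => ?_)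
    measurable_snd)
  by_cases hi : i ≠ x
  · simp only [dif_pos hi]; fun_prop
  · simp only [dif_neg hi]; exact measurable_const

/-- Averaging over the potential at `x` bounds negative fractional moments of affine functions
of that potential. -/
theorem lintegral_mul_inv_enorm_rpow_le (h : IsRandomStripModel μ d D₀ D₁ V U) (x : Strip W)
    {g : StripState W → ℝ} (hg : Measurable g) (hgx : ∀ σ, g σ = σ.1 x + g (resetSite x σ))
    {w : StripState W → ENNReal} (hw : Measurable w) (hwx : ∀ σ, w (resetSite x σ) = w σ) :
    ∫⁻ ω, w (sampleState V U ω) * (‖g (sampleState V U ω)‖ₑ ^ (1 / 4 : ℝ))⁻¹ ∂μ ≤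
      singularMomentBound D₀ * ∫⁻ ω, w (sampleState V U ω) ∂μ := by
  obtain ⟨ρ, hρm, -, hρD, hρ⟩ := h.density_V
  have hX := h.measurable_V x
  have hY : Measurable fun ω => resetSite x (sampleState V U ω) :=
    (measurable_resetSite x).comp h.measurable_sampleState
  have := Measure.isProbabilityMeasure_map (μ := μ) hX.aemeasurable
  have := Measure.isProbabilityMeasure_map (μ := μ) hY.aemeasurable
  have hF : Measurable fun p : ℝ × StripState W =>
      w p.2 * (‖p.1 + g p.2‖ₑ ^ (1 / 4 : ℝ))⁻¹ := by fun_prop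
  -- Once `w` and `g` are evaluated at the reset state, `V x` appears only as an additive shift;
  -- independence and Tonelli allow integrating it out first.
  calc ∫⁻ ω, w (sampleState V U ω) * (‖g (sampleState V U ω)‖ₑ ^ (1 / 4 : ℝ))⁻¹ ∂μ
      = ∫⁻ ω, w (resetSite x (sampleState V U ω)) *
          (‖V x ω + g (resetSite x (sampleState V U ω))‖ₑ ^ (1 / 4 : ℝ))⁻¹ ∂μ := by
        refine lintegral_congr fun ω => ?_
        rw [hwx, hgx (sampleState V U ω)]
        rfl
    _ = ∫⁻ p, w p.2 * (‖p.1 + g p.2‖ₑ ^ (1 / 4 : ℝ))⁻¹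
          ∂((μ.map (V x)).prod (μ.map fun ω => resetSite x (sampleState V U ω))) := by
        rw [← (h.indepFun_potential_resetSite x).map_prod_eq_prod_map_map hX.aemeasurable
          hY.aemeasurable, lintegral_map hF (hX.prodMk hY)]
    _ = ∫⁻ τ, ∫⁻ a, w τ * (‖a + g τ‖ₑ ^ (1 / 4 : ℝ))⁻¹ ∂(μ.map (V x))
          ∂(μ.map fun ω => resetSite x (sampleState V U ω)) :=
        lintegral_prod_symm _ hF.aemeasurable
    _ ≤ ∫⁻ τ, singularMomentBound D₀ * w τ ∂(μ.map fun ω => resetSite x (sampleState V U ω)) := by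
        refine lintegral_mono fun τ => ?_
        rw [lintegral_const_mul _ (by fun_prop), mul_comm]
        exact mul_le_mul_left (lintegral_inv_enorm_add_rpow_le hρm hρD (hρ x) (g τ)) _
    _ = singularMomentBound D₀ * ∫⁻ ω, w (sampleState V U ω) ∂μ := by
        rw [lintegral_const_mul _ hw, lintegral_map hw hY]
        simp only [hwx]

theorem lintegral_inv_schurComplement_le (h : IsRandomStripModel μ d D₀ D₁ V U) (E : ℝ)
    {x : Strip W} {T : Finset (Strip W)} (hx : x ∉ T) :
    ∫⁻ ω, (‖schurComplement (stripMatrix E (sampleState V U ω)) T x x‖ₑ ^ (1 / 4 : ℝ))⁻¹ ∂μ ≤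
      singularMomentBound D₀ := by
  have := h.lintegral_mul_inv_enorm_rpow_le x
    (measurable_schurComplement (measurable_stripMatrix E) T x x)
    (schurComplement_resetSite_self E hx) (w := fun _ => 1) measurable_const fun _ => rfl
  simpa using this

/-- At a zero the extended inverse equals `⊤`, so finiteness of the negative moment excludes zeros
almost surely. -/
theorem ae_schurComplement_ne_zero (h : IsRandomStripModel μ d D₀ D₁ V U) (E : ℝ)
    {x : Strip W} {T : Finset (Strip W)} (hx : x ∉ T) :
    ∀ᵐ ω ∂μ, schurComplement (stripMatrix E (sampleState V U ω)) T x x ≠ 0 := by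
  have hm : Measurable fun ω => schurComplement (stripMatrix E (sampleState V U ω)) T x x :=
    (measurable_schurComplement (measurable_stripMatrix E) T x x).comp h.measurable_sampleState
  have := ae_lt_top (f := fun ω =>
    (‖schurComplement (stripMatrix E (sampleState V U ω)) T x x‖ₑ ^ (1 / 4 : ℝ))⁻¹) (by fun_prop)
    (ne_top_of_le_ne_top (singularMomentBound_ne_top D₀) (h.lintegral_inv_schurComplement_le E hx))
  filter_upwards [this] with ω hω h0
  rw [h0] at hω
  simp at hω

theorem ae_principalMinor_ne_zero (h : IsRandomStripModel μ d D₀ D₁ V U) (E : ℝ)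
    (T : Finset (Strip W)) :
    ∀ᵐ ω ∂μ, principalMinor (stripMatrix E (sampleState V U ω)) T ≠ 0 := by
  induction T using Finset.induction_on with
  | empty => simp [principalMinor_empty]
  | insert x T hx ih =>
    filter_upwards [ih, h.ae_schurComplement_ne_zero E hx] with ω h1 h2
    rw [principalMinor_insert _ hx h1]
    exact mul_ne_zero h1 h2

/-- For `y = z` the entry is the inverse of a Schur complement. For `y ≠ z` it is an off-diagonal
entry of the inverse of a 2 × 2 matrix, dominated by four inverses, each of a quantity affine with
slope one in the potential at `y` or at `z`. The weight `w` depends on the matrices only, so that it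
is not affected by either averaging. -/
theorem lintegral_greenFunction_le (h : IsRandomStripModel μ d D₀ D₁ V U) (E : ℝ)
    {T : Finset (Strip W)} {y z : Strip W} (hy : y ∈ T) (hz : z ∈ T)
    {w : (ℤ × Fin W × Fin W → ℝ) → ENNReal} (hw : Measurable w) :
    ∫⁻ ω, w (sampleState V U ω).2 *
        ‖greenFunction (stripMatrix E (sampleState V U ω)) T y z‖ₑ ^ (1 / 4 : ℝ) ∂μ ≤
      4 * singularMomentBound D₀ * ∫⁻ ω, w (sampleState V U ω).2 ∂μ := by
  have hw' : Measurable fun σ : StripState W => w σ.2 := hw.comp measurable_snd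
  rcases eq_or_ne y z with rfl | hyz
  · have hT : insert y (T.erase y) = T := Finset.insert_erase hy
    have hy' : y ∉ T.erase y := Finset.notMem_erase y T
    calc _ ≤ ∫⁻ ω, w (sampleState V U ω).2 *
          (‖schurComplement (stripMatrix E (sampleState V U ω)) (T.erase y) y y‖ₑ ^
            (1 / 4 : ℝ))⁻¹ ∂μ := by
          refine lintegral_mono_ae ?_
          filter_upwards [h.ae_principalMinor_ne_zero E T,
            h.ae_principalMinor_ne_zero E (T.erase y)] with ω h1 h2
          rw [← hT] at h1
          have := greenFunction_insert_self _ hy' h2 h1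
          rw [hT] at this
          rw [this, ← ENNReal.inv_rpow]
          gcongr
          exact enorm_inv_le
      _ ≤ singularMomentBound D₀ * ∫⁻ ω, w (sampleState V U ω).2 ∂μ :=
          h.lintegral_mul_inv_enorm_rpow_le y
            (measurable_schurComplement (measurable_stripMatrix E) _ y y)
            (schurComplement_resetSite_self E hy') hw' fun _ => rfl
      _ ≤ 4 * singularMomentBound D₀ * ∫⁻ ω, w (sampleState V U ω).2 ∂μ := by
          gcongr
          exact le_mul_of_one_le_left zero_le (by norm_num)
  · set R := (T.erase y).erase z with hR
    have hyR : y ∉ R := fun hh => Finset.notMem_erase y T (Finset.mem_of_mem_erase hh)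
    have hzR : z ∉ R := Finset.notMem_erase z _
    have hT : ({y, z} : Finset (Strip W)) ∪ R = T := by
      rw [Finset.insert_union, ← Finset.insert_eq, hR,
        Finset.insert_erase (Finset.mem_erase.2 ⟨hyz.symm, hz⟩), Finset.insert_erase hy]
    have hdis : Disjoint ({y, z} : Finset (Strip W)) R := by
      rw [Finset.disjoint_insert_left, Finset.disjoint_singleton_left]
      exact ⟨hyR, hzR⟩
    set G : Strip W → Strip W → StripState W → ℝ :=
      fun i j σ => schurComplement (stripMatrix E σ) R i j with hG
    have hGm : ∀ i j, Measurable (G i j) :=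
      fun i j => measurable_schurComplement (measurable_stripMatrix E) R i j
    have hGy : ∀ i j σ, ¬(i = y ∧ j = y) → G i j (resetSite y σ) = G i j σ :=
      fun i j σ hh => schurComplement_resetSite_of_ne E hyR σ hh
    have hGz : ∀ i j σ, ¬(i = z ∧ j = z) → G i j (resetSite z σ) = G i j σ :=
      fun i j σ hh => schurComplement_resetSite_of_ne E hzR σ hh
    have hGyy : ∀ σ, G y y σ = σ.1 y + G y y (resetSite y σ) :=
      schurComplement_resetSite_self E hyR
    have hGzz : ∀ σ, G z z σ = σ.1 z + G z z (resetSite z σ) :=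
      schurComplement_resetSite_self E hzR
    -- In the 2 × 2 Schur complement, the potential at a site enters only the diagonal entry of that
    -- site.
    have a1 : ∀ σ, G y z (resetSite y σ) = G y z σ := fun σ => hGy _ _ _ fun hh => hyz hh.2.symm
    have a2 : ∀ σ, G z z (resetSite y σ) = G z z σ := fun σ => hGy _ _ _ fun hh => hyz hh.2.symm
    have a3 : ∀ σ, G y z (resetSite z σ) = G y z σ := fun σ => hGz _ _ _ fun hh => hyz hh.1
    have a4 : ∀ σ, G y y (resetSite z σ) = G y y σ := fun σ => hGz _ _ _ fun hh => hyz hh.1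
    have m1 := hGm y y
    have m2 := hGm y z
    have m3 := hGm z z
    have k1 := h.lintegral_mul_inv_enorm_rpow_le y
      (g := fun σ => G y y σ - G y z σ * G y z σ / G z z σ) (by fun_prop)
      (fun σ => by simp only [a1, a2, hGyy σ]; ring) hw' fun _ => rfl
    have k2 := h.lintegral_mul_inv_enorm_rpow_le z
      (g := fun σ => G z z σ - G y z σ * G y z σ / G y y σ) (by fun_prop)
      (fun σ => by simp only [a3, a4, hGzz σ]; ring) hw' fun _ => rfl
    have k3 := h.lintegral_mul_inv_enorm_rpow_le y
      (g := fun σ => G y y σ - G y z σ) (by fun_prop)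
      (fun σ => by simp only [a1, hGyy σ]; ring) hw' fun _ => rfl
    have k4 := h.lintegral_mul_inv_enorm_rpow_le y
      (g := fun σ => G y y σ + G y z σ) (by fun_prop)
      (fun σ => by simp only [a1, hGyy σ]; ring) hw' fun _ => rfl
    have hS := h.measurable_sampleState
    calc _ ≤ ∫⁻ ω, (w (sampleState V U ω).2 * (‖G y y (sampleState V U ω) -
            G y z (sampleState V U ω) * G y z (sampleState V U ω) /
              G z z (sampleState V U ω)‖ₑ ^ (1 / 4 : ℝ))⁻¹ +
          w (sampleState V U ω).2 * (‖G z z (sampleState V U ω) -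
            G y z (sampleState V U ω) * G y z (sampleState V U ω) /
              G y y (sampleState V U ω)‖ₑ ^ (1 / 4 : ℝ))⁻¹ +
          w (sampleState V U ω).2 * (‖G y y (sampleState V U ω) -
            G y z (sampleState V U ω)‖ₑ ^ (1 / 4 : ℝ))⁻¹ +
          w (sampleState V U ω).2 * (‖G y y (sampleState V U ω) +
            G y z (sampleState V U ω)‖ₑ ^ (1 / 4 : ℝ))⁻¹) ∂μ := by
          refine lintegral_mono_ae ?_
          filter_upwards [h.ae_principalMinor_ne_zero E T,
            h.ae_principalMinor_ne_zero E R] with ω h1 h2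
          rw [← hT] at h1
          have e := greenFunction_union _ hdis h2 h1 (i := y) (j := z) (by simp) (by simp)
          rw [hT, greenFunction_pair _ hyz,
            (schurComplement_symm (h.isSymm_stripMatrix E ω) R).apply y z] at e
          rw [e, ← mul_add, ← mul_add, ← mul_add]
          gcongr
          exact enorm_div_det_two_rpow_le _ _ _
      _ ≤ singularMomentBound D₀ * ∫⁻ ω, w (sampleState V U ω).2 ∂μ +
          singularMomentBound D₀ * ∫⁻ ω, w (sampleState V U ω).2 ∂μ +
          singularMomentBound D₀ * ∫⁻ ω, w (sampleState V U ω).2 ∂μ +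
          singularMomentBound D₀ * ∫⁻ ω, w (sampleState V U ω).2 ∂μ := by
          clear_value G
          generalize sampleState V U = S at hS k1 k2 k3 k4 ⊢
          rw [lintegral_add_left (by fun_prop), lintegral_add_left (by fun_prop),
            lintegral_add_left (by fun_prop)]
          exact add_le_add (add_le_add (add_le_add k1 k2) k3) k4
      _ = 4 * singularMomentBound D₀ * ∫⁻ ω, w (sampleState V U ω).2 ∂μ := by ring

end IsRandomStripModel

/-! ### Positive fractional moments -/

section Tail

/-- The bound for the moments of order `1/2` under the tail bound `D / T`. -/
def tailMomentBound (D : ℝ) : ENNReal :=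
  ENNReal.ofReal (1 / 2) * ((∫⁻ t in Set.Ioc (0 : ℝ) 1, ENNReal.ofReal (t ^ (1 / 2 - 1 : ℝ))) +
    ∫⁻ t in Set.Ioi (1 : ℝ), ENNReal.ofReal (D * t ^ (-(3 / 2) : ℝ)))

theorem tailMomentBound_ne_top (D : ℝ) : tailMomentBound D ≠ ⊤ := by
  refine ENNReal.mul_ne_top ENNReal.ofReal_ne_top (ENNReal.add_ne_top.2 ⟨?_, ?_⟩)
  · have := intervalIntegral.intervalIntegrable_rpow' (a := 0) (b := 1)
      (show (-1 : ℝ) < 1 / 2 - 1 by norm_num)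
    rw [intervalIntegrable_iff_integrableOn_Ioc_of_le zero_le_one] at this
    exact this.lintegral_lt_top.ne
  · have := (integrableOn_Ioi_rpow_of_lt (show (-(3 / 2) : ℝ) < -1 by norm_num)
      zero_lt_one).const_mul D
    exact this.lintegral_lt_top.ne

/-- Layer-cake formula: the probability is bounded by 1 for `t ≤ 1` and by `D / t` beyond, where
`t^(-3/2)` is integrable. -/
theorem lintegral_enorm_rpow_half_le {Ω : Type*} [MeasurableSpace Ω] {μ : Measure Ω}
    [IsProbabilityMeasure μ] {X : Ω → ℝ} (hX : Measurable X) {D : ℝ}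
    (hD : ∀ T : ℝ, 1 ≤ T → μ.real {ω | T ≤ |X ω|} ≤ D / T) :
    ∫⁻ ω, ‖X ω‖ₑ ^ (1 / 2 : ℝ) ∂μ ≤ tailMomentBound D := by
  have h1 := lintegral_rpow_eq_lintegral_meas_le_mul μ (f := fun ω => |X ω|)
    (Filter.Eventually.of_forall fun ω => abs_nonneg _) (by fun_prop)
    (show (0 : ℝ) < 1 / 2 by norm_num)
  have h2 : ∀ ω, ‖X ω‖ₑ ^ (1 / 2 : ℝ) = ENNReal.ofReal (|X ω| ^ (1 / 2 : ℝ)) := fun ω => by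
    rw [← ENNReal.ofReal_rpow_of_nonneg (abs_nonneg _) (by norm_num), ← Real.norm_eq_abs,
      ofReal_norm]
  simp only [h2]
  rw [h1, tailMomentBound, ← Set.Ioc_union_Ioi_eq_Ioi (zero_le_one (α := ℝ)),
    lintegral_union measurableSet_Ioi (Set.Ioc_disjoint_Ioi le_rfl)]
  refine mul_le_mul' le_rfl (add_le_add ?_ ?_)
  · refine lintegral_mono fun t => ?_
    exact mul_le_of_le_one_left zero_le prob_le_one
  · refine setLIntegral_mono' measurableSet_Ioi fun t ht => ?_
    have ht0 : (0 : ℝ) < t := zero_lt_one.trans ht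
    have hm := hD t (le_of_lt ht)
    have hDt : 0 ≤ D / t := measureReal_nonneg.trans hm
    have e : D * t ^ (-(3 / 2) : ℝ) = D / t * t ^ (1 / 2 - 1 : ℝ) := by
      rw [div_eq_mul_inv D t, mul_assoc, ← Real.rpow_neg_one t, ← Real.rpow_add ht0]
      norm_num
    rw [e, ENNReal.ofReal_mul hDt]
    gcongr
    rw [← ofReal_measureReal]
    exact ENNReal.ofReal_le_ofReal hm

end Tail

section Estimates

theorem enorm_sum_rpow_le {ι : Type*} (s : Finset ι) (f : ι → ℝ) :
    ‖∑ i ∈ s, f i‖ₑ ^ (1 / 4 : ℝ) ≤ ∑ i ∈ s, ‖f i‖ₑ ^ (1 / 4 : ℝ) := by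
  classical
  induction s using Finset.induction_on with
  | empty => simp
  | insert a s ha ih =>
    rw [Finset.sum_insert ha, Finset.sum_insert ha]
    refine (ENNReal.rpow_le_rpow (enorm_add_le _ _) (by norm_num)).trans ?_
    refine (ENNReal.rpow_add_le_add_rpow _ _ (by norm_num) (by norm_num)).trans ?_
    gcongr

theorem enorm_sub_rpow_le (a b : ℝ) :
    ‖a - b‖ₑ ^ (1 / 4 : ℝ) ≤ ‖a‖ₑ ^ (1 / 4 : ℝ) + ‖b‖ₑ ^ (1 / 4 : ℝ) :=
  (ENNReal.rpow_le_rpow enorm_sub_le (by norm_num)).trans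
    (ENNReal.rpow_add_le_add_rpow _ _ (by norm_num) (by norm_num))

/-- Two off-diagonal entries multiply each entry of the inverse, and they may be dependent. This
trades their product for moments of order 1/2, which the `1 / T` tails allow. -/
theorem rpow_quarter_mul_le (a b : ENNReal) :
    a ^ (1 / 4 : ℝ) * b ^ (1 / 4 : ℝ) ≤ a ^ (1 / 2 : ℝ) + b ^ (1 / 2 : ℝ) := by
  have e : ∀ c : ENNReal, c ^ (1 / 4 : ℝ) * c ^ (1 / 4 : ℝ) = c ^ (1 / 2 : ℝ) := fun c => by
    rw [← ENNReal.rpow_add_of_nonneg _ _ (by norm_num) (by norm_num)]; norm_num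
  rcases le_total a b with h | h
  · calc _ ≤ b ^ (1 / 4 : ℝ) * b ^ (1 / 4 : ℝ) := by gcongr
      _ ≤ _ := by rw [e]; exact le_add_self
  · calc _ ≤ a ^ (1 / 4 : ℝ) * a ^ (1 / 4 : ℝ) := by gcongr
      _ ≤ _ := by rw [e]; exact le_self_add

theorem rpow_quarter_le (a : ENNReal) : a ^ (1 / 4 : ℝ) ≤ 1 + a ^ (1 / 2 : ℝ) := by
  have := rpow_quarter_mul_le a 1
  simpa [add_comm] using this

theorem abs_entry_le_norm_toEuclideanCLM {W : ℕ} (M : Matrix (Fin W) (Fin W) ℝ) (x y : Fin W) :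
    |M x y| ≤ ‖Matrix.toEuclideanCLM (n := Fin W) (𝕜 := ℝ) M‖ := by
  have h1 : (Matrix.toEuclideanCLM (n := Fin W) (𝕜 := ℝ) M (EuclideanSpace.single y 1)) x =
      M x y := by
    simp [Matrix.ofLp_toEuclideanCLM, Matrix.mulVec_single]
  have h2 := PiLp.norm_apply_le
    (Matrix.toEuclideanCLM (n := Fin W) (𝕜 := ℝ) M (EuclideanSpace.single y 1)) x
  rw [h1] at h2
  refine h2.trans ((ContinuousLinearMap.le_opNorm _ _).trans ?_)
  simp

/-- Two sites are near if the corresponding entry of the matrix of the operator may be nonzero. -/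
def StripNear {W : ℕ} (d : ℕ) (i j : Strip W) : Prop :=
  (i.2 = j.2 ∧ |i.1 - j.1| = 1) ∨ (i.1 = j.1 ∧ |(i.2 : ℤ) - (j.2 : ℤ)| ≤ d)

theorem stripNear_comm {W d : ℕ} {i j : Strip W} : StripNear d i j ↔ StripNear d j i := by
  unfold StripNear
  rw [eq_comm, abs_sub_comm i.1, eq_comm (a := i.1), abs_sub_comm (i.2 : ℤ)]

open Classical in
theorem card_filter_stripNear_le {W : ℕ} (d : ℕ) (i : Strip W) (T : Finset (Strip W)) :
    (T.filter (StripNear d i)).card ≤ 2 * d + 3 := by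
  set B : Finset (Fin W) := Finset.univ.filter fun y => |(i.2 : ℤ) - (y : ℤ)| ≤ d with hB
  have hBc : B.card ≤ 2 * d + 1 := by
    have h1 : B.card ≤ (Finset.Icc ((i.2 : ℤ) - d) ((i.2 : ℤ) + d)).card := by
      refine Finset.card_le_card_of_injOn (fun y => ((y : ℕ) : ℤ)) ?_ ?_
      · intro y hy
        have := (Finset.mem_filter.1 hy).2
        rw [abs_le] at this
        simp only [Finset.coe_Icc, Set.mem_Icc]
        omega
      · intro y _ z _ hyz
        exact Fin.ext (Int.ofNat.inj hyz)
    refine h1.trans ?_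
    rw [Int.card_Icc]
    omega
  have hsub : T.filter (StripNear d i) ⊆
      ({(i.1 - 1, i.2), (i.1 + 1, i.2)} : Finset (Strip W)) ∪ B.image fun y => (i.1, y) := by
    rintro ⟨n, y⟩ hj
    rcases (Finset.mem_filter.1 hj).2 with ⟨h1, h2⟩ | ⟨h1, h2⟩
    · dsimp only at h1 h2
      rw [abs_eq (by norm_num)] at h2
      refine Finset.mem_union_left _ ?_
      rw [Finset.mem_insert, Finset.mem_singleton, h1]
      rcases h2 with h2 | h2
      · left; congr 1; omega
      · right; congr 1; omega
    · refine Finset.mem_union_right _ (Finset.mem_image.2 ⟨y, ?_, ?_⟩)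
      · exact Finset.mem_filter.2 ⟨Finset.mem_univ _, h2⟩
      · dsimp only at h1
        rw [h1]
  -- Two neighbours along the strip and at most `2 d + 1` sites in the same column.
  refine (Finset.card_le_card hsub).trans ((Finset.card_union_le _ _).trans ?_)
  have := Finset.card_le_two (a := (i.1 - 1, i.2)) (b := (i.1 + 1, i.2))
  have := Finset.card_image_le (s := B) (f := fun y => (i.1, y))
  omega

end Estimates

/-- The bound for the moments of the off-diagonal entries. -/
def offDiagonalBound (D₁ : ℝ) : ENNReal := 1 + tailMomentBound D₁

/-- The bound for the positive fractional moments of the Schur complement of a site. -/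
def schurMomentBound (d : ℕ) (D₀ D₁ absE : ℝ) : ENNReal :=
  ((1 + tailMomentBound D₁) + (1 + tailMomentBound D₁) + ENNReal.ofReal absE ^ (1 / 4 : ℝ)) +
    ((2 * d + 3 : ℕ) : ENNReal) * (((2 * d + 3 : ℕ) : ENNReal) *
      (4 * singularMomentBound D₀ * (offDiagonalBound D₁ + offDiagonalBound D₁)))

theorem schurMomentBound_ne_top (d : ℕ) (D₀ D₁ absE : ℝ) : schurMomentBound d D₀ D₁ absE ≠ ⊤ := by
  have h1 := tailMomentBound_ne_top D₁
  have h2 := singularMomentBound_ne_top D₀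
  have h3 : ENNReal.ofReal absE ^ (1 / 4 : ℝ) ≠ ⊤ :=
    ENNReal.rpow_ne_top_of_nonneg (by norm_num) ENNReal.ofReal_ne_top
  have h4 : (4 : ENNReal) ≠ ⊤ := by norm_num
  have h5 : ((2 * d + 3 : ℕ) : ENNReal) ≠ ⊤ := ENNReal.natCast_ne_top _
  have h6 : offDiagonalBound D₁ ≠ ⊤ := ENNReal.add_ne_top.2 ⟨ENNReal.one_ne_top, h1⟩
  refine ENNReal.add_ne_top.2 ⟨ENNReal.add_ne_top.2 ⟨ENNReal.add_ne_top.2 ⟨h6, h6⟩, h3⟩, ?_⟩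
  exact ENNReal.mul_ne_top h5 (ENNReal.mul_ne_top h5
    (ENNReal.mul_ne_top (ENNReal.mul_ne_top h4 h2) (ENNReal.add_ne_top.2 ⟨h6, h6⟩)))

namespace IsRandomStripModel

variable {Ω : Type*} [MeasurableSpace Ω] {μ : Measure Ω} {W d : ℕ}
  {D₀ D₁ : ℝ} {V : Strip W → Ω → ℝ} {U : ℤ → Ω → Matrix (Fin W) (Fin W) ℝ}

theorem stripMatrix_eq_zero (h : IsRandomStripModel μ d D₀ D₁ V U) (E : ℝ) {i j : Strip W}
    (hij : i ≠ j) (hn : ¬StripNear d i j) (ω : Ω) :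
    stripMatrix E (sampleState V U ω) i j = 0 := by
  simp only [StripNear, not_or] at hn
  simp only [stripMatrix, Matrix.of_apply, sampleState, hij, if_false, if_neg hn.1]
  by_cases h1 : i.1 = j.1
  · have h2 : ¬|(i.2 : ℤ) - (j.2 : ℤ)| ≤ d := fun hh => hn.2 ⟨h1, hh⟩
    rw [if_pos h1, h.band_U _ _ _ _ (not_le.1 h2)]
    simp
  · simp [h1]

variable [IsProbabilityMeasure μ]

theorem lintegral_enorm_potential_le (h : IsRandomStripModel μ d D₀ D₁ V U) (x : Strip W) :
    ∫⁻ ω, ‖V x ω‖ₑ ^ (1 / 2 : ℝ) ∂μ ≤ tailMomentBound D₁ :=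
  lintegral_enorm_rpow_half_le (h.measurable_V x) (h.tail_V x)

theorem lintegral_enorm_entry_le (h : IsRandomStripModel μ d D₀ D₁ V U) (n : ℤ) (x y : Fin W) :
    ∫⁻ ω, ‖U n ω x y‖ₑ ^ (1 / 2 : ℝ) ∂μ ≤ tailMomentBound D₁ := by
  refine lintegral_enorm_rpow_half_le (h.measurable_U n x y) fun T hT => ?_
  refine (measureReal_mono ?_).trans (h.tail_U n T hT)
  exact fun ω hω => le_trans hω (abs_entry_le_norm_toEuclideanCLM _ x y)

theorem lintegral_enorm_offDiagonal_le (h : IsRandomStripModel μ d D₀ D₁ V U) (E : ℝ)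
    {i j : Strip W} (hij : i ≠ j) :
    ∫⁻ ω, ‖stripMatrix E (sampleState V U ω) i j‖ₑ ^ (1 / 2 : ℝ) ∂μ ≤ offDiagonalBound D₁ := by
  have key : ∀ ω, ‖stripMatrix E (sampleState V U ω) i j‖ₑ ^ (1 / 2 : ℝ) ≤
      1 + ‖U i.1 ω i.2 j.2‖ₑ ^ (1 / 2 : ℝ) := by
    intro ω
    simp only [stripMatrix, Matrix.of_apply, sampleState, hij, if_false, add_zero, sub_zero]
    by_cases h1 : i.1 = j.1
    · simp [h1]
    · rw [if_neg h1, sub_zero]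
      split_ifs <;> simp
  calc _ ≤ ∫⁻ ω, 1 + ‖U i.1 ω i.2 j.2‖ₑ ^ (1 / 2 : ℝ) ∂μ := lintegral_mono key
    _ ≤ _ := by
      rw [lintegral_add_left measurable_const, offDiagonalBound]
      simp only [lintegral_const, measure_univ, mul_one]
      gcongr
      exact h.lintegral_enorm_entry_le _ _ _

-- The double sum runs over all of `T × T`, but only pairs of sites near `x` contribute, at most
-- `(2d+3)^2` of them; hence a bound independent of `T` and `W`. Subadditivity of the power 1/4
-- handles the sum without any independence between its terms.
open Classical in
theorem lintegral_schurComplement_le (h : IsRandomStripModel μ d D₀ D₁ V U) (E : ℝ)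
    {x : Strip W} {T : Finset (Strip W)} (hx : x ∉ T) :
    ∫⁻ ω, ‖schurComplement (stripMatrix E (sampleState V U ω)) T x x‖ₑ ^ (1 / 4 : ℝ) ∂μ ≤
      schurMomentBound d D₀ D₁ |E| := by
  have hS := h.measurable_sampleState
  have hxT : ∀ y ∈ T, x ≠ y := fun y hy hxy => hx (hxy ▸ hy)
  have hAm : ∀ i j, Measurable fun ω => stripMatrix E (sampleState V U ω) i j :=
    fun i j => (measurable_stripMatrix E i j).comp hS
  have hGm : ∀ i j, Measurable fun ω => greenFunction (stripMatrix E (sampleState V U ω)) T i j :=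
    fun i j => (measurable_greenFunction (measurable_stripMatrix E) T i j).comp hS
  have hVm := h.measurable_V x
  have hUm := h.measurable_U x.1 x.2 x.2
  set K : ENNReal := 4 * singularMomentBound D₀ * (offDiagonalBound D₁ + offDiagonalBound D₁)
    with hK
  have hterm : ∀ y ∈ T, ∀ z ∈ T, ∫⁻ ω, ‖stripMatrix E (sampleState V U ω) x y *
      greenFunction (stripMatrix E (sampleState V U ω)) T y z *
      stripMatrix E (sampleState V U ω) z x‖ₑ ^ (1 / 4 : ℝ) ∂μ ≤
      if StripNear d x y then (if StripNear d x z then K else 0) else 0 := by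
    intro y hy z hz
    by_cases hny : StripNear d x y
    swap
    · simp [h.stripMatrix_eq_zero E (hxT y hy) hny]
    by_cases hnz : StripNear d x z
    swap
    · have := h.stripMatrix_eq_zero E (hxT z hz).symm fun hh => hnz (stripNear_comm.1 hh)
      simp [this]
    rw [if_pos hny, if_pos hnz]
    -- Off-diagonal entries do not involve the potentials, so they can serve as the weight in
    -- `lintegral_greenFunction_le`.
    have hoff : ∀ {i j : Strip W}, i ≠ j → ∀ σ : StripState W,
        stripMatrix E σ i j = stripMatrix E (0, σ.2) i j := by
      intro i j hij σ
      simp [stripMatrix, hij]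
    have hm0 : ∀ i j, Measurable fun u : ℤ × Fin W × Fin W → ℝ =>
        stripMatrix E ((0, u) : StripState W) i j :=
      fun i j => (measurable_stripMatrix E i j).comp (measurable_const.prodMk measurable_id)
    have hw : Measurable fun u : ℤ × Fin W × Fin W → ℝ =>
        ‖stripMatrix E ((0, u) : StripState W) x y‖ₑ ^ (1 / 4 : ℝ) *
          ‖stripMatrix E ((0, u) : StripState W) z x‖ₑ ^ (1 / 4 : ℝ) :=
      ((hm0 x y).enorm.pow_const _).mul ((hm0 z x).enorm.pow_const _)
    have := h.lintegral_greenFunction_le E hy hz hw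
    simp only [← hoff (hxT y hy), ← hoff (hxT z hz).symm] at this
    calc _ = ∫⁻ ω, ‖stripMatrix E (sampleState V U ω) x y‖ₑ ^ (1 / 4 : ℝ) *
            ‖stripMatrix E (sampleState V U ω) z x‖ₑ ^ (1 / 4 : ℝ) *
            ‖greenFunction (stripMatrix E (sampleState V U ω)) T y z‖ₑ ^ (1 / 4 : ℝ) ∂μ := by
          refine lintegral_congr fun ω => ?_
          rw [enorm_mul, enorm_mul, ENNReal.mul_rpow_of_nonneg _ _ (by norm_num),
            ENNReal.mul_rpow_of_nonneg _ _ (by norm_num)]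
          ring
      _ ≤ _ := this
      _ ≤ K := by
          rw [hK]
          gcongr
          calc _ ≤ ∫⁻ ω, ‖stripMatrix E (sampleState V U ω) x y‖ₑ ^ (1 / 2 : ℝ) +
                ‖stripMatrix E (sampleState V U ω) z x‖ₑ ^ (1 / 2 : ℝ) ∂μ :=
                lintegral_mono fun ω => rpow_quarter_mul_le _ _
            _ ≤ _ := by
                rw [lintegral_add_left ((hAm x y).enorm.pow_const _)]
                exact add_le_add (h.lintegral_enorm_offDiagonal_le E (hxT y hy))
                  (h.lintegral_enorm_offDiagonal_le E (hxT z hz).symm)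
  have hdiag : ∫⁻ ω, ‖stripMatrix E (sampleState V U ω) x x‖ₑ ^ (1 / 4 : ℝ) ∂μ ≤
      (1 + tailMomentBound D₁) + (1 + tailMomentBound D₁) +
        ENNReal.ofReal |E| ^ (1 / 4 : ℝ) := by
    calc _ ≤ ∫⁻ ω, ((1 + ‖V x ω‖ₑ ^ (1 / 2 : ℝ)) + (1 + ‖U x.1 ω x.2 x.2‖ₑ ^ (1 / 2 : ℝ))) +
          ENNReal.ofReal |E| ^ (1 / 4 : ℝ) ∂μ := by
          refine lintegral_mono fun ω => ?_
          have e : stripMatrix E (sampleState V U ω) x x = V x ω - U x.1 ω x.2 x.2 - E := by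
            simp [stripMatrix, sampleState]
          dsimp only
          rw [e, ← Real.norm_eq_abs, ofReal_norm]
          refine (enorm_sub_rpow_le _ _).trans (add_le_add ?_ le_rfl)
          exact (enorm_sub_rpow_le _ _).trans
            (add_le_add (rpow_quarter_le _) (rpow_quarter_le _))
      _ ≤ _ := by
          rw [lintegral_add_left (by fun_prop), lintegral_add_left (by fun_prop),
            lintegral_add_left (by fun_prop), lintegral_add_left (by fun_prop)]
          simp only [lintegral_const, measure_univ, mul_one]
          gcongr
          exacts [h.lintegral_enorm_potential_le x, h.lintegral_enorm_entry_le _ _ _]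
  calc _ ≤ ∫⁻ ω, ‖stripMatrix E (sampleState V U ω) x x‖ₑ ^ (1 / 4 : ℝ) +
        ∑ y ∈ T, ∑ z ∈ T, ‖stripMatrix E (sampleState V U ω) x y *
          greenFunction (stripMatrix E (sampleState V U ω)) T y z *
          stripMatrix E (sampleState V U ω) z x‖ₑ ^ (1 / 4 : ℝ) ∂μ := by
        refine lintegral_mono fun ω => (enorm_sub_rpow_le _ _).trans ?_
        gcongr
        refine (enorm_sum_rpow_le _ _).trans ?_
        gcongr
        exact enorm_sum_rpow_le _ _
    _ = ∫⁻ ω, ‖stripMatrix E (sampleState V U ω) x x‖ₑ ^ (1 / 4 : ℝ) ∂μ +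
        ∑ y ∈ T, ∑ z ∈ T, ∫⁻ ω, ‖stripMatrix E (sampleState V U ω) x y *
          greenFunction (stripMatrix E (sampleState V U ω)) T y z *
          stripMatrix E (sampleState V U ω) z x‖ₑ ^ (1 / 4 : ℝ) ∂μ := by
        have hm : ∀ y z, Measurable fun ω => ‖stripMatrix E (sampleState V U ω) x y *
          greenFunction (stripMatrix E (sampleState V U ω)) T y z *
          stripMatrix E (sampleState V U ω) z x‖ₑ ^ (1 / 4 : ℝ) := fun y z =>
          (((hAm x y).mul (hGm y z)).mul (hAm z x)).enorm.pow_const _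
        rw [lintegral_add_left ((hAm x x).enorm.pow_const _),
          lintegral_finsetSum _ fun y _ => Finset.measurable_sum _ fun z _ => hm y z]
        congr 1
        refine Finset.sum_congr rfl fun y _ => ?_
        rw [lintegral_finsetSum _ fun z _ => hm y z]
    _ ≤ _ := by
        rw [schurMomentBound]
        refine add_le_add hdiag ?_
        calc _ ≤ ∑ y ∈ T, ∑ z ∈ T,
              if StripNear d x y then (if StripNear d x z then K else 0) else 0 :=
              Finset.sum_le_sum fun y hy => Finset.sum_le_sum fun z hz => hterm y hy z hz
          _ = ((T.filter (StripNear d x)).card : ENNReal) *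
              ((T.filter (StripNear d x)).card * K) := by
              have : ∀ y, (∑ z ∈ T,
                  if StripNear d x y then (if StripNear d x z then K else 0) else 0) =
                  if StripNear d x y then ((T.filter (StripNear d x)).card : ENNReal) * K
                  else 0 := by
                intro y
                split_ifs
                · rw [← Finset.sum_filter, Finset.sum_const, nsmul_eq_mul]
                · simp
              simp only [this]
              rw [← Finset.sum_filter, Finset.sum_const, nsmul_eq_mul]
          _ ≤ _ := by
              have hc : ((T.filter (StripNear d x)).card : ENNReal) ≤ ((2 * d + 3 : ℕ) : ENNReal) :=
                by exact_mod_cast card_filter_stripNear_le d x T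
              exact mul_le_mul' hc (mul_le_mul' hc le_rfl)

end IsRandomStripModel

/-! ### Exponential moments of increments of the log-determinant -/

/-- The logarithm of the absolute value of the determinant of `H_T - E`. -/
def logMinor {W : ℕ} (E : ℝ) (T : Finset (Strip W)) (σ : StripState W) : ℝ :=
  Real.log |principalMinor (stripMatrix E σ) T|

theorem measurable_logMinor {W : ℕ} (E : ℝ) (T : Finset (Strip W)) :
    Measurable (logMinor E T) :=
  Real.measurable_log.comp
    (continuous_abs.measurable.comp (measurable_principalMinor (measurable_stripMatrix E) T))

/-- The left side is the larger of `|a|^(1/4)` and `|a|^(-1/4)`; this is why both positive and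
negative moments are needed. -/
theorem ofReal_exp_abs_log_le {a : ℝ} (ha : a ≠ 0) :
    ENNReal.ofReal (Real.exp (1 / 4 * |Real.log (|a|)|)) ≤
      ‖a‖ₑ ^ (1 / 4 : ℝ) + (‖a‖ₑ ^ (1 / 4 : ℝ))⁻¹ := by
  have hpos : 0 < |a| := abs_pos.2 ha
  have e1 : ENNReal.ofReal (Real.exp (1 / 4 * Real.log |a|)) = ‖a‖ₑ ^ (1 / 4 : ℝ) := by
    rw [mul_comm, ← Real.rpow_def_of_pos hpos, ← ENNReal.ofReal_rpow_of_pos hpos,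
      ← Real.norm_eq_abs, ofReal_norm]
  have e2 : ENNReal.ofReal (Real.exp (1 / 4 * -Real.log |a|)) = (‖a‖ₑ ^ (1 / 4 : ℝ))⁻¹ := by
    rw [mul_neg, Real.exp_neg, ENNReal.ofReal_inv_of_pos (Real.exp_pos _), e1]
  rcases abs_choice (Real.log |a|) with h | h <;> rw [h]
  · rw [e1]; exact le_self_add
  · rw [e2]; exact le_add_self

/-- The bound for the exponential moments of the increments of the logarithm of the
determinant. -/
def incrementBound (d : ℕ) (D₀ D₁ absE : ℝ) : ENNReal :=
  1 + (schurMomentBound d D₀ D₁ absE + singularMomentBound D₀)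

theorem incrementBound_ne_top (d : ℕ) (D₀ D₁ absE : ℝ) : incrementBound d D₀ D₁ absE ≠ ⊤ :=
  ENNReal.add_ne_top.2 ⟨ENNReal.one_ne_top,
    ENNReal.add_ne_top.2 ⟨schurMomentBound_ne_top _ _ _ _, singularMomentBound_ne_top _⟩⟩

/-- Convexity of the exponential, for extended nonnegative reals. -/
theorem ofReal_exp_convex {a b θ θ' : ℝ} (h : 0 ≤ θ) (h' : 0 ≤ θ') (hs : θ + θ' = 1) :
    ENNReal.ofReal (Real.exp (θ * a + θ' * b)) ≤
      ENNReal.ofReal θ * ENNReal.ofReal (Real.exp a) +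
        ENNReal.ofReal θ' * ENNReal.ofReal (Real.exp b) := by
  rw [← ENNReal.ofReal_mul h, ← ENNReal.ofReal_mul h', ← ENNReal.ofReal_add (by positivity)
    (by positivity)]
  exact ENNReal.ofReal_le_ofReal
    (convexOn_exp.2 (Set.mem_univ a) (Set.mem_univ b) h h' hs)

/-- The exponential moment of a convex combination is bounded by the bounds for the terms. -/
theorem lintegral_exp_convex_le {Ω : Type*} [MeasurableSpace Ω] {μ : Measure Ω} {X Y : Ω → ℝ}
    (hX : Measurable X) (hY : Measurable Y) {θ θ' : ℝ} (h : 0 ≤ θ) (h' : 0 ≤ θ')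
    (hs : θ + θ' = 1) {B : ENNReal} (hXB : ∫⁻ ω, ENNReal.ofReal (Real.exp (X ω)) ∂μ ≤ B)
    (hYB : ∫⁻ ω, ENNReal.ofReal (Real.exp (Y ω)) ∂μ ≤ B) :
    ∫⁻ ω, ENNReal.ofReal (Real.exp (θ * X ω + θ' * Y ω)) ∂μ ≤ B := by
  calc _ ≤ ∫⁻ ω, ENNReal.ofReal θ * ENNReal.ofReal (Real.exp (X ω)) +
        ENNReal.ofReal θ' * ENNReal.ofReal (Real.exp (Y ω)) ∂μ :=
        lintegral_mono fun ω => ofReal_exp_convex h h' hs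
    _ = ENNReal.ofReal θ * ∫⁻ ω, ENNReal.ofReal (Real.exp (X ω)) ∂μ +
        ENNReal.ofReal θ' * ∫⁻ ω, ENNReal.ofReal (Real.exp (Y ω)) ∂μ := by
        rw [lintegral_add_left (by fun_prop), lintegral_const_mul _ (by fun_prop),
          lintegral_const_mul _ (by fun_prop)]
    _ ≤ ENNReal.ofReal θ * B + ENNReal.ofReal θ' * B := by gcongr
    _ = B := by rw [← add_mul, ← ENNReal.ofReal_add h h', hs, ENNReal.ofReal_one, one_mul]

namespace IsRandomStripModel

variable {Ω : Type*} [MeasurableSpace Ω] {μ : Measure Ω} {W d : ℕ}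
  {D₀ D₁ : ℝ} {V : Strip W → Ω → ℝ} {U : ℤ → Ω → Matrix (Fin W) (Fin W) ℝ}

theorem measurable_logMinor_sampleState (h : IsRandomStripModel μ d D₀ D₁ V U) (E : ℝ)
    (T : Finset (Strip W)) : Measurable fun ω => logMinor E T (sampleState V U ω) :=
  (measurable_logMinor E T).comp h.measurable_sampleState

variable [IsProbabilityMeasure μ]

theorem lintegral_exp_logMinor_insert_le (h : IsRandomStripModel μ d D₀ D₁ V U) (E : ℝ)
    {x : Strip W} {T : Finset (Strip W)} (hx : x ∉ T) :
    ∫⁻ ω, ENNReal.ofReal (Real.exp (1 / 4 * |logMinor E (insert x T) (sampleState V U ω) -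
      logMinor E T (sampleState V U ω)|)) ∂μ ≤ incrementBound d D₀ D₁ |E| := by
  have hm : Measurable fun ω => schurComplement (stripMatrix E (sampleState V U ω)) T x x :=
    (measurable_schurComplement (measurable_stripMatrix E) T x x).comp h.measurable_sampleState
  calc _ ≤ ∫⁻ ω, ‖schurComplement (stripMatrix E (sampleState V U ω)) T x x‖ₑ ^ (1 / 4 : ℝ) +
        (‖schurComplement (stripMatrix E (sampleState V U ω)) T x x‖ₑ ^ (1 / 4 : ℝ))⁻¹ ∂μ := by
        refine lintegral_mono_ae ?_
        filter_upwards [h.ae_principalMinor_ne_zero E T, h.ae_schurComplement_ne_zero E hx]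
          with ω h1 h2
        refine le_trans (le_of_eq ?_) (ofReal_exp_abs_log_le h2)
        simp only [logMinor]
        rw [principalMinor_insert _ hx h1, abs_mul, Real.log_mul (abs_ne_zero.2 h1)
          (abs_ne_zero.2 h2), add_sub_cancel_left]
    _ ≤ _ := by
        rw [lintegral_add_left (by fun_prop), incrementBound]
        exact (add_le_add (h.lintegral_schurComplement_le E hx)
          (h.lintegral_inv_schurComplement_le E hx)).trans le_add_self

/-- Sites are added one at a time. The rate `1 / (4 |S|)` turns the sum of the increments into an
average, and convexity of the exponential bounds it by the worst single increment, without
independence. -/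
theorem lintegral_exp_logMinor_union_card_le (h : IsRandomStripModel μ d D₀ D₁ V U) (E : ℝ)
    (S T : Finset (Strip W)) (hST : Disjoint S T) :
    ∫⁻ ω, ENNReal.ofReal (Real.exp (1 / (4 * S.card) *
      |logMinor E (S ∪ T) (sampleState V U ω) - logMinor E T (sampleState V U ω)|)) ∂μ ≤
      incrementBound d D₀ D₁ |E| := by
  induction S using Finset.induction_on with
  | empty =>
    simp only [Finset.empty_union, sub_self, abs_zero, mul_zero, Real.exp_zero,
      ENNReal.ofReal_one, lintegral_const, measure_univ, mul_one]
    -- The summand 1 in `incrementBound` is there for the empty set.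
    exact le_self_add
  | insert x S hx ih =>
    rw [Finset.disjoint_insert_left] at hST
    have hxu : x ∉ S ∪ T := by
      rw [Finset.mem_union]
      exact fun hh => hh.elim hx hST.1
    have h1 := ih hST.2
    have h2 := h.lintegral_exp_logMinor_insert_le E hxu
    set n : ℝ := (S.card : ℝ) with hn
    have hn0 : 0 ≤ n := Nat.cast_nonneg _
    have hm1 := h.measurable_logMinor_sampleState E (S ∪ T)
    have hm2 := h.measurable_logMinor_sampleState E (insert x (S ∪ T))
    have hm3 := h.measurable_logMinor_sampleState E T
    have hm4 : Measurable fun ω => 1 / (4 * n) *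
      |logMinor E (S ∪ T) (sampleState V U ω) - logMinor E T (sampleState V U ω)| :=
      (continuous_abs.measurable.comp (hm1.sub hm3)).const_mul _
    have hm5 : Measurable fun ω => 1 / 4 *
      |logMinor E (insert x (S ∪ T)) (sampleState V U ω) -
        logMinor E (S ∪ T) (sampleState V U ω)| :=
      (continuous_abs.measurable.comp (hm2.sub hm1)).const_mul _
    refine le_trans (lintegral_mono fun ω => ?_) (lintegral_exp_convex_le hm4 hm5
      (θ := n / (n + 1)) (θ' := 1 / (n + 1)) (by positivity) (by positivity) (by field_simp)
      h1 h2)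
    refine ENNReal.ofReal_le_ofReal (Real.exp_le_exp.2 ?_)
    rw [Finset.card_insert_of_notMem hx, Finset.insert_union]
    push_cast
    rw [← hn]
    set a := logMinor E (insert x (S ∪ T)) (sampleState V U ω)
    set b := logMinor E (S ∪ T) (sampleState V U ω)
    set c := logMinor E T (sampleState V U ω)
    have h3 : |a - c| ≤ |b - c| + |a - b| := by
      have := abs_add_le (b - c) (a - b)
      rwa [show b - c + (a - b) = a - c by ring] at this
    have h4 : n / (n + 1) * (1 / (4 * n) * |b - c|) = 1 / (4 * (n + 1)) * |b - c| := by
      -- For `n = 0` the factor `1 / (4 n)` is zero by convention, and the identity holds because `b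
      -- = c`.
      rcases eq_or_ne n 0 with h0 | h0
      · have hS : S = ∅ := by
          rw [hn, Nat.cast_eq_zero, Finset.card_eq_zero] at h0
          exact h0
        have : b = c := by simp only [b, c, hS, Finset.empty_union]
        rw [this]
        simp
      · field_simp
    rw [h4, show 1 / (n + 1) * (1 / 4 * |a - b|) = 1 / (4 * (n + 1)) * |a - b| by field_simp,
      ← mul_add]
    gcongr

/-- Removing a set `S` of sites changes the logarithm of the determinant by an amount of order
`|S|`, in the sense of exponential moments. -/
theorem lintegral_exp_logMinor_union_le (h : IsRandomStripModel μ d D₀ D₁ V U) (E : ℝ)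
    {S T : Finset (Strip W)} (hST : Disjoint S T) {m : ℝ} (hm : (S.card : ℝ) ≤ m) :
    ∫⁻ ω, ENNReal.ofReal (Real.exp (1 / (4 * m) *
      |logMinor E (S ∪ T) (sampleState V U ω) - logMinor E T (sampleState V U ω)|)) ∂μ ≤
      incrementBound d D₀ D₁ |E| := by
  refine (lintegral_mono fun ω => ?_).trans (h.lintegral_exp_logMinor_union_card_le E S T hST)
  refine ENNReal.ofReal_le_ofReal (Real.exp_le_exp.2 ?_)
  rcases S.eq_empty_or_nonempty with rfl | hS
  · simp
  · have : (0 : ℝ) < S.card := by exact_mod_cast hS.card_pos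
    gcongr

end IsRandomStripModel

/-! ### From exponential moments to local subgaussian bounds -/

section LocalSubgaussian

variable {Ω : Type*} [MeasurableSpace Ω] {μ : Measure Ω}

theorem exp_le_one_add_add_sq_mul_exp (x : ℝ) :
    Real.exp x ≤ 1 + x + x ^ 2 * Real.exp |x| := by
  have h := Complex.norm_exp_sub_sum_le_norm_mul_exp (x : ℂ) 2
  have e : Complex.exp x - ∑ m ∈ Finset.range 2, (x : ℂ) ^ m / (m.factorial : ℂ) =
      ((Real.exp x - (1 + x) : ℝ) : ℂ) := by
    simp [Finset.sum_range_succ]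
  rw [e, Complex.norm_real, Complex.norm_real, Real.norm_eq_abs, Real.norm_eq_abs, sq_abs] at h
  linarith [le_abs_self (Real.exp x - (1 + x))]

theorem integrable_of_lintegral_exp_le {R : Ω → ℝ} (hR : Measurable R) {s : ℝ} (hs : 0 < s)
    {B : ENNReal} (hB : B ≠ ⊤)
    (h : ∫⁻ ω, ENNReal.ofReal (Real.exp (s * |R ω|)) ∂μ ≤ B) :
    Integrable (fun ω => Real.exp (s * |R ω|)) μ ∧ Integrable R μ := by
  have h1 : Integrable (fun ω => Real.exp (s * |R ω|)) μ := by
    refine ⟨by fun_prop, ?_⟩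
    rw [hasFiniteIntegral_iff_ofReal (Filter.Eventually.of_forall fun ω => (Real.exp_pos _).le)]
    exact lt_of_le_of_lt h hB.lt_top
  refine ⟨h1, (h1.const_mul (1 / s)).mono' hR.aestronglyMeasurable
    (Filter.Eventually.of_forall fun ω => ?_)⟩
  rw [Real.norm_eq_abs, one_div, ← div_eq_inv_mul, le_div_iff₀ hs, mul_comm]
  linarith [Real.add_one_le_exp (s * |R ω|)]

/-- The exponential moments of the sum of two independent variables and of a third one. -/
theorem lintegral_exp_add_add_le {X Y Z : Ω → ℝ} (hX : Measurable X) (hY : Measurable Y)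
    (hZ : Measurable Z) (hXY : IndepFun X Y μ) {p q : ℝ} (hpq : p.HolderConjugate q)
    {t a b c : ℝ} (hab : a + b ≤ c)
    (h1 : ∫⁻ ω, ENNReal.ofReal (Real.exp (p * t * X ω)) ∂μ ≤ ENNReal.ofReal (Real.exp a))
    (h2 : ∫⁻ ω, ENNReal.ofReal (Real.exp (p * t * Y ω)) ∂μ ≤ ENNReal.ofReal (Real.exp b))
    (h3 : ∫⁻ ω, ENNReal.ofReal (Real.exp (q * t * Z ω)) ∂μ ≤ ENNReal.ofReal (Real.exp c)) :
    ∫⁻ ω, ENNReal.ofReal (Real.exp (t * (X ω + Y ω + Z ω))) ∂μ ≤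
      ENNReal.ofReal (Real.exp c) := by
  have h4 : ∫⁻ ω, ENNReal.ofReal (Real.exp (p * t * (X ω + Y ω))) ∂μ ≤
      ENNReal.ofReal (Real.exp c) := by
    have hi : IndepFun (fun ω => ENNReal.ofReal (Real.exp (p * t * X ω)))
        (fun ω => ENNReal.ofReal (Real.exp (p * t * Y ω))) μ :=
      hXY.comp (φ := fun x => ENNReal.ofReal (Real.exp (p * t * x)))
        (ψ := fun x => ENNReal.ofReal (Real.exp (p * t * x))) (by fun_prop) (by fun_prop)
    calc _ = ∫⁻ ω, ENNReal.ofReal (Real.exp (p * t * X ω)) *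
          ENNReal.ofReal (Real.exp (p * t * Y ω)) ∂μ := by
          refine lintegral_congr fun ω => ?_
          rw [← ENNReal.ofReal_mul (Real.exp_pos _).le, ← Real.exp_add, mul_add]
      _ = (∫⁻ ω, ENNReal.ofReal (Real.exp (p * t * X ω)) ∂μ) *
          ∫⁻ ω, ENNReal.ofReal (Real.exp (p * t * Y ω)) ∂μ :=
          lintegral_mul_eq_lintegral_mul_lintegral_of_indepFun'' (by fun_prop) (by fun_prop) hi
      _ ≤ ENNReal.ofReal (Real.exp a) * ENNReal.ofReal (Real.exp b) := mul_le_mul' h1 h2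
      _ = ENNReal.ofReal (Real.exp (a + b)) := by
          rw [← ENNReal.ofReal_mul (Real.exp_pos _).le, ← Real.exp_add]
      _ ≤ _ := ENNReal.ofReal_le_ofReal (Real.exp_le_exp.2 hab)
  have hp := hpq.pos
  have hq := hpq.symm.pos
  -- Convexity with weights `1/p` and `1/q` replaces Hölder's inequality: both factors have the same
  -- bound `exp c`, so nothing is lost.
  refine le_trans (le_of_eq ?_) (lintegral_exp_convex_le (θ := p⁻¹) (θ' := q⁻¹)
    (X := fun ω => p * t * (X ω + Y ω)) (Y := fun ω => q * t * Z ω) (by fun_prop) (by fun_prop)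
    (by positivity) (by positivity) hpq.inv_add_inv_eq_one h4 h3)
  refine lintegral_congr fun ω => ?_
  congr 2
  field_simp

variable [IsProbabilityMeasure μ]

/-- A random variable with an exponential moment is locally subgaussian. -/
theorem lintegral_exp_mul_sub_integral_le {R : Ω → ℝ} (hR : Measurable R) {s : ℝ} (hs : 0 < s)
    {B : ENNReal} (hB : B ≠ ⊤)
    (h : ∫⁻ ω, ENNReal.ofReal (Real.exp (s * |R ω|)) ∂μ ≤ B) {t : ℝ} (ht : |t| ≤ s / 2) :
    ∫⁻ ω, ENNReal.ofReal (Real.exp (t * (R ω - ∫ ω', R ω' ∂μ))) ∂μ ≤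
      ENNReal.ofReal (Real.exp (8 * B.toReal * Real.exp B.toReal * t ^ 2 / s ^ 2)) := by
  obtain ⟨hi1, hi2⟩ := integrable_of_lintegral_exp_le hR hs hB h
  set C := B.toReal with hC
  have hEC : ∫ ω, Real.exp (s * |R ω|) ∂μ ≤ C := by
    rw [integral_eq_lintegral_of_nonneg_ae
      (Filter.Eventually.of_forall fun ω => (Real.exp_pos _).le) hi1.1]
    exact ENNReal.toReal_mono hB h
  set e := ∫ ω', R ω' ∂μ with he
  -- `C` bounds both the exponential moment and `s |e|`; centering then costs a factor `exp C`,
  -- whence the form `C exp C` of the constant.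
  have hEe : s * |e| ≤ C := by
    have h1 : |e| ≤ ∫ ω, |R ω| ∂μ := abs_integral_le_integral_abs
    calc s * |e| ≤ s * ∫ ω, |R ω| ∂μ := by gcongr
      _ = ∫ ω, s * |R ω| ∂μ := (integral_const_mul _ _).symm
      _ ≤ ∫ ω, Real.exp (s * |R ω|) ∂μ :=
          integral_mono (hi2.abs.const_mul s) hi1
            fun ω => by linarith [Real.add_one_le_exp (s * |R ω|)]
      _ ≤ C := hEC
  have key : ∀ ω, Real.exp (t * (R ω - e)) ≤
      1 + t * (R ω - e) + 8 * t ^ 2 / s ^ 2 * Real.exp C * Real.exp (s * |R ω|) := by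
    intro ω
    refine (exp_le_one_add_add_sq_mul_exp _).trans (add_le_add le_rfl ?_)
    set y := R ω - e with hy
    -- The exponential budget `s |y|` is split in two: one half bounds `exp |t y|`, the other
    -- absorbs the factor `y²`.
    have h1 : |t * y| ≤ s * |y| / 2 := by
      rw [abs_mul]
      nlinarith [abs_nonneg y]
    have h2 : (s * |y| / 2) ^ 2 / 2 ≤ Real.exp (s * |y| / 2) := by
      have := Real.quadratic_le_exp_of_nonneg (x := s * |y| / 2) (by positivity)
      have h0 : 0 ≤ s * |y| / 2 := by positivity
      linarith
    have h3 : y ^ 2 ≤ 8 / s ^ 2 * Real.exp (s * |y| / 2) := by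
      rw [div_mul_eq_mul_div, le_div_iff₀ (by positivity), ← sq_abs y]
      nlinarith
    have h4 : s * |y| ≤ C + s * |R ω| := by
      have : |y| ≤ |R ω| + |e| := abs_sub _ _
      nlinarith
    calc (t * y) ^ 2 * Real.exp |t * y| ≤
          t ^ 2 * (8 / s ^ 2 * Real.exp (s * |y| / 2)) * Real.exp (s * |y| / 2) := by
          rw [mul_pow]
          gcongr
      _ = 8 * t ^ 2 / s ^ 2 * Real.exp (s * |y|) := by
          rw [show s * |y| = s * |y| / 2 + s * |y| / 2 by ring, Real.exp_add]
          ring_nf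
      _ ≤ 8 * t ^ 2 / s ^ 2 * Real.exp (C + s * |R ω|) := by gcongr
      _ = _ := by rw [Real.exp_add]; ring
  have hint1 : Integrable (fun ω => t * (R ω - e)) μ := (hi2.sub (integrable_const e)).const_mul t
  have hint2 : Integrable (fun ω => 1 + t * (R ω - e)) μ := (integrable_const 1).add hint1
  have hint3 : Integrable (fun ω => 8 * t ^ 2 / s ^ 2 * Real.exp C * Real.exp (s * |R ω|)) μ :=
    hi1.const_mul _
  have hz : ∫ ω, t * (R ω - e) ∂μ = 0 := by
    rw [integral_const_mul, integral_sub hi2 (integrable_const e)]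
    simp [he]
  calc _ ≤ ∫⁻ ω, ENNReal.ofReal (1 + t * (R ω - e) +
          8 * t ^ 2 / s ^ 2 * Real.exp C * Real.exp (s * |R ω|)) ∂μ :=
        lintegral_mono fun ω => ENNReal.ofReal_le_ofReal (key ω)
    _ = ENNReal.ofReal (∫ ω, 1 + t * (R ω - e) +
          8 * t ^ 2 / s ^ 2 * Real.exp C * Real.exp (s * |R ω|) ∂μ) :=
        (ofReal_integral_eq_lintegral_ofReal (hint2.add hint3)
          (Filter.Eventually.of_forall fun ω => (Real.exp_pos _).le.trans (key ω))).symm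
    _ ≤ _ := by
        refine ENNReal.ofReal_le_ofReal ?_
        rw [integral_add hint2 hint3, integral_add (integrable_const 1) hint1, hz,
          integral_const_mul]
        simp only [integral_const, probReal_univ, smul_eq_mul, mul_one, add_zero]
        have h5 : 8 * t ^ 2 / s ^ 2 * Real.exp C * ∫ ω, Real.exp (s * |R ω|) ∂μ ≤
            8 * t ^ 2 / s ^ 2 * Real.exp C * C := by gcongr
        have h6 := Real.add_one_le_exp (8 * C * Real.exp C * t ^ 2 / s ^ 2)
        have h7 : 8 * t ^ 2 / s ^ 2 * Real.exp C * C = 8 * C * Real.exp C * t ^ 2 / s ^ 2 := by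
          ring
        linarith

end LocalSubgaussian

/-! ### Separators in rectangles -/

section Geometry

variable {W : ℕ}

/-- The rows of the strip with `p ≤ x < q`. -/
def rowBand (W p q : ℕ) : Finset (Fin W) := Finset.univ.filter fun x => p ≤ (x : ℕ) ∧ (x : ℕ) < q

theorem mem_rowBand {p q : ℕ} {x : Fin W} : x ∈ rowBand W p q ↔ p ≤ (x : ℕ) ∧ (x : ℕ) < q := by
  simp [rowBand]

theorem card_rowBand_le (p q : ℕ) : (rowBand W p q).card ≤ q - p := by
  rw [← Nat.card_Ico]
  refine Finset.card_le_card_of_injOn (fun x => (x : ℕ)) ?_ fun x _ y _ hxy => Fin.ext hxy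
  intro x hx
  simpa using mem_rowBand.1 hx

theorem isRectangular_rowBand (hW : 0 < W) (a b : ℤ) (p q : ℕ) :
    IsRectangular (Finset.Icc a b ×ˢ rowBand W p q) := by
  by_cases h : p < q ∧ p < W
  · refine ⟨a, b, ⟨p, h.2⟩, ⟨min q W - 1, by omega⟩, ?_⟩
    congr 1
    ext x
    have := x.2
    rw [mem_rowBand, Finset.mem_Icc, Fin.le_def, Fin.le_def]
    dsimp only
    omega
  · have he : rowBand W p q = ∅ := by
      ext x
      have := x.2
      simp only [mem_rowBand, Finset.notMem_empty, iff_false]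
      omega
    -- An empty set of rows is written as a product with the empty interval from 1 to 0.
    refine ⟨1, 0, ⟨0, hW⟩, ⟨0, hW⟩, ?_⟩
    rw [he]
    simp

/-- A rectangle can be cut in two decoupled rectangles of at most half the size, by removing
a separator whose size is of the order of the shorter side. -/
theorem IsRectangular.exists_separator {Λ : Finset (Strip W)} (hΛ : IsRectangular Λ)
    (hne : Λ.Nonempty) {d : ℕ} (hd : 0 < d) :
    ∃ S Λ₁ Λ₂ : Finset (Strip W), IsRectangular Λ₁ ∧ IsRectangular Λ₂ ∧ Λ = S ∪ (Λ₁ ∪ Λ₂) ∧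
      Disjoint S (Λ₁ ∪ Λ₂) ∧ Disjoint Λ₁ Λ₂ ∧ 2 * Λ₁.card ≤ Λ.card ∧ 2 * Λ₂.card ≤ Λ.card ∧
      S.card ^ 2 ≤ d ^ 2 * Λ.card ∧ ∀ i ∈ Λ₁, ∀ j ∈ Λ₂, ¬StripNear d i j := by
  obtain ⟨a, b, c, e, rfl⟩ := hΛ
  obtain ⟨⟨n, x⟩, hnx⟩ := hne
  rw [Finset.mem_product, Finset.mem_Icc, Finset.mem_Icc] at hnx
  have hab : a ≤ b := hnx.1.1.trans hnx.1.2
  have hce : (c : ℕ) ≤ e := Fin.le_def.1 (hnx.2.1.trans hnx.2.2)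
  have hW : 0 < W := lt_of_le_of_lt (Nat.zero_le _) x.2
  -- The cut goes across the longer direction: one column if the rectangle is at least as long as it
  -- is wide, otherwise `d` consecutive rows. The square of the shorter side is at most the area.
  by_cases hcmp : (e : ℕ) + 1 - c ≤ (b + 1 - a).toNat
  · set m := (a + b) / 2 with hm
    refine ⟨Finset.Icc m m ×ˢ Finset.Icc c e, Finset.Icc a (m - 1) ×ˢ Finset.Icc c e,
      Finset.Icc (m + 1) b ×ˢ Finset.Icc c e, ⟨_, _, _, _, rfl⟩, ⟨_, _, _, _, rfl⟩,
      ?_, ?_, ?_, ?_, ?_, ?_, ?_⟩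
    · ext ⟨k, y⟩
      simp only [Finset.mem_union, Finset.mem_product, Finset.mem_Icc]
      omega
    · rw [Finset.disjoint_left]
      rintro ⟨k, y⟩
      simp only [Finset.mem_union, Finset.mem_product, Finset.mem_Icc]
      omega
    · rw [Finset.disjoint_left]
      rintro ⟨k, y⟩
      simp only [Finset.mem_product, Finset.mem_Icc]
      omega
    · rw [Finset.card_product, Finset.card_product, ← mul_assoc]
      refine Nat.mul_le_mul_right _ ?_
      rw [Int.card_Icc, Int.card_Icc]
      omega
    · rw [Finset.card_product, Finset.card_product, ← mul_assoc]
      refine Nat.mul_le_mul_right _ ?_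
      rw [Int.card_Icc, Int.card_Icc]
      omega
    · rw [Finset.card_product, Finset.card_product, Int.card_Icc, Int.card_Icc, Fin.card_Icc]
      have h1 : (m + 1 - m).toNat = 1 := by omega
      rw [h1, one_mul]
      calc ((e : ℕ) + 1 - c) ^ 2 ≤ 1 * ((b + 1 - a).toNat * ((e : ℕ) + 1 - c)) := by
            rw [sq, one_mul]; exact Nat.mul_le_mul_right _ hcmp
        _ ≤ _ := Nat.mul_le_mul_right _ (Nat.one_le_pow _ _ hd)
    · rintro ⟨k, y⟩ hi ⟨l, z⟩ hj hnear
      simp only [Finset.mem_product, Finset.mem_Icc] at hi hj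
      rcases hnear with ⟨-, h2⟩ | ⟨h1, -⟩
      · dsimp only at h2
        rw [abs_eq (by norm_num)] at h2
        omega
      · dsimp only at h1
        omega
  · push Not at hcmp
    set k := ((e : ℕ) + 1 - c) / 2 with hk
    have hI : Finset.Icc c e = rowBand W c (e + 1) := by
      ext y
      rw [mem_rowBand, Finset.mem_Icc, Fin.le_def, Fin.le_def]
      omega
    have hw : (rowBand W c (e + 1)).card = (e : ℕ) + 1 - c := by rw [← hI, Fin.card_Icc]
    rw [hI]
    -- Removing `d` rows leaves rows at distance at least `d + 1`, beyond the range of the matrices.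
    -- The minimum truncates the separator at the edge of the rectangle; the upper part is then
    -- empty.
    refine ⟨Finset.Icc a b ×ˢ rowBand W (c + k) (min (c + k + d) (e + 1)),
      Finset.Icc a b ×ˢ rowBand W c (c + k),
      Finset.Icc a b ×ˢ rowBand W (c + k + d) (e + 1), isRectangular_rowBand hW _ _ _ _,
      isRectangular_rowBand hW _ _ _ _, ?_, ?_, ?_, ?_, ?_, ?_, ?_⟩
    · ext ⟨l, y⟩
      simp only [Finset.mem_union, Finset.mem_product, mem_rowBand]
      by_cases hl : l ∈ Finset.Icc a b <;> simp only [hl, true_and, false_and, or_self]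
      omega
    · rw [Finset.disjoint_left]
      rintro ⟨l, y⟩
      simp only [Finset.mem_union, Finset.mem_product, mem_rowBand]
      omega
    · rw [Finset.disjoint_left]
      rintro ⟨l, y⟩
      simp only [Finset.mem_product, mem_rowBand]
      omega
    · rw [Finset.card_product, Finset.card_product, mul_left_comm, hw]
      refine Nat.mul_le_mul_left _ ?_
      have := card_rowBand_le (W := W) c (c + k)
      omega
    · rw [Finset.card_product, Finset.card_product, mul_left_comm, hw]
      refine Nat.mul_le_mul_left _ ?_
      have := card_rowBand_le (W := W) (c + k + d) (e + 1)
      omega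
    · rw [Finset.card_product, Finset.card_product, hw, Int.card_Icc]
      have h1 := card_rowBand_le (W := W) (c + k) (min (c + k + d) (e + 1))
      have h2 : (rowBand W (c + k) (min (c + k + d) (e + 1))).card ≤ d := by omega
      calc _ ≤ ((b + 1 - a).toNat * d) ^ 2 := by gcongr
        _ = d ^ 2 * ((b + 1 - a).toNat * (b + 1 - a).toNat) := by ring
        _ ≤ _ := by gcongr
    · rintro ⟨l, y⟩ hi ⟨l', z⟩ hj hnear
      simp only [Finset.mem_product, mem_rowBand] at hi hj
      rcases hnear with ⟨h1, -⟩ | ⟨-, h2⟩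
      · dsimp only at h1
        rw [h1] at hi
        omega
      · dsimp only at h2
        rw [abs_le] at h2
        omega

end Geometry

/-! ### Independence and additivity for decoupled rectangles -/

/-- The logarithm of the determinant only depends on the potentials and on the block of the
matrices in the set. -/
theorem exists_logMinor_eq_comp {Ω : Type*} (E : ℝ) (T : Finset (Strip W)) :
    ∃ Φ : (T → ℝ) × (T → T → ℝ) → ℝ, Measurable Φ ∧
      ∀ (V : Strip W → Ω → ℝ) (U : ℤ → Ω → Matrix (Fin W) (Fin W) ℝ) (ω : Ω),
        logMinor E T (sampleState V U ω) =
          Φ (fun i => V i ω, blockOn (fun n => U n ω) T) := by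
  refine ⟨fun p => Real.log |(Matrix.of fun i j : T =>
    (if i.1.2 = j.1.2 ∧ |i.1.1 - j.1.1| = 1 then -1 else 0) + (if i = j then p.1 i else 0) -
      p.2 i j - (if i = j then E else 0) : Matrix T T ℝ).det|, ?_, ?_⟩
  · refine Real.measurable_log.comp (continuous_abs.measurable.comp
      (measurable_matrix_det fun i j => ?_))
    simp only [Matrix.of_apply]
    have h1 : Measurable fun p : (T → ℝ) × (T → T → ℝ) => p.1 i :=
      (measurable_pi_apply i).comp measurable_fst
    have h2 : Measurable fun p : (T → ℝ) × (T → T → ℝ) => p.2 i j := by fun_prop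
    refine ((measurable_const.add ?_).sub h2).sub measurable_const
    split_ifs
    exacts [h1, measurable_const]
  · intro V U ω
    unfold logMinor principalMinor
    congr 3
    ext i j
    simp only [Matrix.submatrix_apply, stripMatrix, Matrix.of_apply, sampleState, blockOn,
      Subtype.ext_iff]

namespace IsRandomStripModel

variable {Ω : Type*} [MeasurableSpace Ω] {μ : Measure Ω} {W d : ℕ}
  {D₀ D₁ : ℝ} {V : Strip W → Ω → ℝ} {U : ℤ → Ω → Matrix (Fin W) (Fin W) ℝ}

theorem measurable_blockOn (h : IsRandomStripModel μ d D₀ D₁ V U) (T : Finset (Strip W)) :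
    Measurable fun ω => blockOn (fun n => U n ω) T := by
  refine measurable_pi_lambda _ fun i => measurable_pi_lambda _ fun j => ?_
  unfold blockOn
  split_ifs
  exacts [h.measurable_U _ _ _, measurable_const]

variable [IsProbabilityMeasure μ]

/-- Each log-determinant is a function of the potentials and the matrix block inside its own
rectangle; the two potential families, and the two blocks, are independent, and potentials are
independent of blocks. -/
theorem indepFun_logMinor (h : IsRandomStripModel μ d D₀ D₁ V U) (E : ℝ)
    {Λ₁ Λ₂ : Finset (Strip W)} (h₁ : IsRectangular Λ₁) (h₂ : IsRectangular Λ₂)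
    (hd : Disjoint Λ₁ Λ₂) :
    IndepFun (fun ω => logMinor E Λ₁ (sampleState V U ω))
      (fun ω => logMinor E Λ₂ (sampleState V U ω)) μ := by
  obtain ⟨Φ₁, hΦ₁, e₁⟩ := exists_logMinor_eq_comp (Ω := Ω) E Λ₁
  obtain ⟨Φ₂, hΦ₂, e₂⟩ := exists_logMinor_eq_comp (Ω := Ω) E Λ₂
  have hV : IndepFun (fun ω (i : Λ₁) => V i ω) (fun ω (i : Λ₂) => V i ω) μ :=
    h.indep_V.indepFun_finset Λ₁ Λ₂ hd h.measurable_V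
  have hU : IndepFun (fun ω => blockOn (fun n => U n ω) Λ₁)
      (fun ω => blockOn (fun n => U n ω) Λ₂) μ := by
    have := h.indep_blocks_U 2 ![Λ₁, Λ₂] (by
      intro i
      fin_cases i
      exacts [h₁, h₂]) (by
      intro i j hij
      fin_cases i <;> fin_cases j
      exacts [absurd rfl hij, hd, hd.symm, absurd rfl hij])
    exact this.indepFun (i := 0) (j := 1) (by decide)
  have hVU : IndepFun (fun ω => (fun (i : Λ₁) => V i ω, fun (i : Λ₂) => V i ω))
      (fun ω => (blockOn (fun n => U n ω) Λ₁, blockOn (fun n => U n ω) Λ₂)) μ := by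
    have hb : ∀ T : Finset (Strip W), Measurable fun u : ℤ × Fin W × Fin W → ℝ =>
        blockOn (fun n => Matrix.of fun x y => u (n, x, y)) T := by
      intro T
      refine measurable_pi_lambda _ fun i => measurable_pi_lambda _ fun j => ?_
      unfold blockOn
      split_ifs
      exacts [measurable_pi_apply _, measurable_const]
    have hv : Measurable fun v : Strip W → ℝ =>
        (fun (i : Λ₁) => v i, fun (i : Λ₂) => v i) := by fun_prop
    exact h.indep_V_U.comp hv ((hb Λ₁).prodMk (hb Λ₂))
  have key := indepFun_prodMk_prodMk_comm
    (measurable_pi_lambda _ fun i : Λ₁ => h.measurable_V i)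
    (measurable_pi_lambda _ fun i : Λ₂ => h.measurable_V i)
    (h.measurable_blockOn Λ₁) (h.measurable_blockOn Λ₂) hV hU hVU
  simp only [e₁, e₂]
  exact key.comp hΦ₁ hΦ₂

/-- If two sets of sites are decoupled, then the logarithm of the determinant is additive. -/
theorem ae_logMinor_union (h : IsRandomStripModel μ d D₀ D₁ V U) (E : ℝ)
    {Λ₁ Λ₂ : Finset (Strip W)} (hd : Disjoint Λ₁ Λ₂)
    (hn : ∀ i ∈ Λ₁, ∀ j ∈ Λ₂, ¬StripNear d i j) :
    ∀ᵐ ω ∂μ, logMinor E (Λ₁ ∪ Λ₂) (sampleState V U ω) =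
      logMinor E Λ₁ (sampleState V U ω) + logMinor E Λ₂ (sampleState V U ω) := by
  filter_upwards [h.ae_principalMinor_ne_zero E Λ₁, h.ae_principalMinor_ne_zero E Λ₂]
    with ω h1 h2
  have h3 : ∀ i ∈ Λ₁, ∀ j ∈ Λ₂, stripMatrix E (sampleState V U ω) i j = 0 := fun i hi j hj =>
    h.stripMatrix_eq_zero E (fun hij : i = j => Finset.disjoint_left.1 hd hi (hij ▸ hj)) (hn i hi j hj) ω
  simp only [logMinor]
  rw [principalMinor_union_of_decoupled _ hd h3, abs_mul,
    Real.log_mul (abs_ne_zero.2 h1) (abs_ne_zero.2 h2)]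

theorem integrable_logMinor (h : IsRandomStripModel μ d D₀ D₁ V U) (E : ℝ)
    (T : Finset (Strip W)) : Integrable (fun ω => logMinor E T (sampleState V U ω)) μ := by
  have hm := h.measurable_logMinor_sampleState E T
  -- All sites are added to the empty set, whose log-determinant is 0. The extra 1 keeps the rate
  -- well defined and positive when `T` is empty.
  have h1 := h.lintegral_exp_logMinor_union_le E (S := T) (T := ∅) (Finset.disjoint_empty_right _)
    (m := T.card + 1) (by linarith)
  have h2 : ∀ σ : StripState W, logMinor E (∅ : Finset (Strip W)) σ = 0 := fun σ => by
    simp [logMinor, principalMinor_empty]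
  simp only [Finset.union_empty, h2, sub_zero] at h1
  exact (integrable_of_lintegral_exp_le hm (by positivity) (incrementBound_ne_top _ _ _ _) h1).2

end IsRandomStripModel

/-! ### The recursion over halved rectangles -/

/-- The variance proxy in the bound for the exponential moments of the logarithm of the
determinant; `q` is the Hölder exponent that is used for the separators. -/
def varianceProxy (d : ℕ) (D₀ D₁ absE q : ℝ) : ℝ :=
  16 * (8 * (incrementBound d D₀ D₁ absE).toReal *
    Real.exp (incrementBound d D₀ D₁ absE).toReal) * q ^ 2 * d ^ 2

theorem varianceProxy_nonneg (d : ℕ) (D₀ D₁ absE q : ℝ) : 0 ≤ varianceProxy d D₀ D₁ absE q := by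
  unfold varianceProxy
  positivity

/-- Superadditivity with a gain when a number is split in two parts of at most half its size. -/
theorem two_rpow_mul_add_rpow_le {n n₁ n₂ δ : ℝ} (h₁ : 0 ≤ n₁) (h₂ : 0 ≤ n₂) (hδ : 0 ≤ δ)
    (h₁' : 2 * n₁ ≤ n) (h₂' : 2 * n₂ ≤ n) :
    2 ^ δ * (n₁ ^ (1 + δ) + n₂ ^ (1 + δ)) ≤ n ^ (1 + δ) := by
  have hn : 0 ≤ n := by linarith
  have key : ∀ k : ℝ, 0 ≤ k → 2 * k ≤ n → 2 ^ δ * k ^ (1 + δ) ≤ k * n ^ δ := by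
    intro k hk hkn
    rw [Real.rpow_add' hk (by linarith), Real.rpow_one, mul_left_comm,
      ← Real.mul_rpow zero_le_two hk]
    gcongr
  have e : n ^ (1 + δ) = n * n ^ δ := by rw [Real.rpow_add' hn (by linarith), Real.rpow_one]
  have := Real.rpow_nonneg hn δ
  rw [mul_add, e]
  calc _ ≤ n₁ * n ^ δ + n₂ * n ^ δ := add_le_add (key _ h₁ h₁') (key _ h₂ h₂')
    _ = (n₁ + n₂) * n ^ δ := by ring
    _ ≤ n * n ^ δ := by gcongr; linarith

namespace IsRandomStripModel

variable {Ω : Type*} [MeasurableSpace Ω] {μ : Measure Ω} [IsProbabilityMeasure μ] {W d : ℕ}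
  {D₀ D₁ : ℝ} {V : Strip W → Ω → ℝ} {U : ℤ → Ω → Matrix (Fin W) (Fin W) ℝ}

/-- The exponential moments of the centered logarithm of the determinant on a rectangle. -/
theorem lintegral_exp_centered_logMinor_le (h : IsRandomStripModel μ d D₀ D₁ V U) (E : ℝ)
    (hd : 0 < d) {δ : ℝ} (hδ : 0 < δ) (hδ1 : δ ≤ 1) {q : ℝ}
    (hpq : ((2 : ℝ) ^ (δ / 2)).HolderConjugate q) (N : ℕ) :
    ∀ Λ : Finset (Strip W), IsRectangular Λ → Λ.card = N → ∀ t : ℝ,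
      |t| * √N ≤ 1 / (8 * q * d) →
      ∫⁻ ω, ENNReal.ofReal (Real.exp (t * (logMinor E Λ (sampleState V U ω) -
        ∫ ω', logMinor E Λ (sampleState V U ω') ∂μ))) ∂μ ≤
      ENNReal.ofReal (Real.exp (varianceProxy d D₀ D₁ |E| q * (N : ℝ) ^ (1 + δ) * t ^ 2)) := by
  induction N using Nat.strong_induction_on with
  | _ N ih =>
  intro Λ hΛ hcard t ht
  set M := varianceProxy d D₀ D₁ |E| q with hM
  have hM0 : 0 ≤ M := varianceProxy_nonneg _ _ _ _ _
  rcases Λ.eq_empty_or_nonempty with rfl | hne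
  · have h0 : ∀ σ : StripState W, logMinor E (∅ : Finset (Strip W)) σ = 0 := fun σ => by
      simp [logMinor, principalMinor_empty]
    simp only [h0, integral_zero, sub_self, mul_zero, Real.exp_zero, ENNReal.ofReal_one,
      lintegral_const, measure_univ, mul_one]
    rw [ENNReal.one_le_ofReal, Real.one_le_exp_iff]
    positivity
  obtain ⟨S, Λ₁, Λ₂, hr₁, hr₂, hunion, hSd, hd12, hc₁, hc₂, hSc, hnear⟩ :=
    hΛ.exists_separator hne hd
  rw [hcard] at hc₁ hc₂ hSc
  have hN : 0 < N := hcard ▸ hne.card_pos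
  have hNR : (1 : ℝ) ≤ N := by exact_mod_cast hN
  have hdR : (0 : ℝ) < d := by exact_mod_cast hd
  have hsq : 0 < √(N : ℝ) := Real.sqrt_pos.2 (by linarith)
  have hsq2 : √(N : ℝ) ^ 2 = N := Real.sq_sqrt (by linarith)
  set p : ℝ := (2 : ℝ) ^ (δ / 2) with hp
  have hp0 : 0 < p := hpq.pos
  have hq0 : 0 < q := hpq.symm.pos
  have hp2 : p ^ 2 = 2 ^ δ := by
    rw [hp, ← Real.rpow_natCast, ← Real.rpow_mul zero_le_two]
    congr 1
    push_cast
    ring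
  -- This compensates the halving: `p √(N/2) ≤ √N`, so the admissible range of `t` is inherited by
  -- `p t` on the two halves.
  have hp2' : p ^ 2 ≤ 2 := by
    rw [hp2]
    calc (2 : ℝ) ^ δ ≤ 2 ^ (1 : ℝ) := Real.rpow_le_rpow_of_exponent_le one_le_two hδ1
      _ = 2 := Real.rpow_one 2
  -- the two halves
  have hhalf : ∀ Λ' : Finset (Strip W), IsRectangular Λ' → 2 * Λ'.card ≤ N →
      ∫⁻ ω, ENNReal.ofReal (Real.exp (p * t * (logMinor E Λ' (sampleState V U ω) -
        ∫ ω', logMinor E Λ' (sampleState V U ω') ∂μ))) ∂μ ≤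
      ENNReal.ofReal (Real.exp (M * (Λ'.card : ℝ) ^ (1 + δ) * (p * t) ^ 2)) := by
    intro Λ' hr hc
    refine ih Λ'.card (by omega) Λ' hr rfl (p * t) (le_trans ?_ ht)
    have hcR : 2 * (Λ'.card : ℝ) ≤ N := by exact_mod_cast hc
    have : p * √(Λ'.card : ℝ) ≤ √(N : ℝ) := by
      refine Real.le_sqrt_of_sq_le ?_
      rw [mul_pow, Real.sq_sqrt (Nat.cast_nonneg _)]
      nlinarith [(Nat.cast_nonneg Λ'.card : (0 : ℝ) ≤ Λ'.card)]
    calc |p * t| * √(Λ'.card : ℝ) = |t| * (p * √(Λ'.card : ℝ)) := by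
          rw [abs_mul, abs_of_pos hp0]; ring
      _ ≤ |t| * √(N : ℝ) := by gcongr
  -- the separator
  set R : Ω → ℝ := fun ω => logMinor E Λ (sampleState V U ω) -
    logMinor E (Λ₁ ∪ Λ₂) (sampleState V U ω) with hR
  have hm : ∀ T, Measurable fun ω => logMinor E T (sampleState V U ω) :=
    h.measurable_logMinor_sampleState E
  have hRm : Measurable R := (hm Λ).sub (hm _)
  have hScard : (S.card : ℝ) ≤ d * √(N : ℝ) := by
    refine abs_le_of_sq_le_sq' ?_ (by positivity) |>.2
    rw [mul_pow, hsq2]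
    exact_mod_cast hSc
  have hs : 0 < 1 / (4 * (d * √(N : ℝ))) := by positivity
  have hRexp := h.lintegral_exp_logMinor_union_le E hSd hScard
  rw [← hunion] at hRexp
  -- The local subgaussian bound at rate `s = 1 / (4 d √N)` requires `|q t| ≤ s / 2`; this is the
  -- origin of `1 / (8 q d)`.
  have hqt : |q * t| ≤ 1 / (4 * (d * √(N : ℝ))) / 2 := by
    rw [abs_mul, abs_of_pos hq0]
    calc q * |t| = q * (|t| * √(N : ℝ)) / √(N : ℝ) := by field_simp
      _ ≤ q * (1 / (8 * q * d)) / √(N : ℝ) := by gcongr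
      _ = 1 / (4 * (d * √(N : ℝ))) / 2 := by field_simp; norm_num
  have hthird : ∫⁻ ω, ENNReal.ofReal (Real.exp (q * t * (R ω - ∫ ω', R ω' ∂μ))) ∂μ ≤
      ENNReal.ofReal (Real.exp (M * (N : ℝ) ^ (1 + δ) * t ^ 2)) := by
    refine (lintegral_exp_mul_sub_integral_le hRm hs (incrementBound_ne_top _ _ _ _)
      hRexp hqt).trans (ENNReal.ofReal_le_ofReal (Real.exp_le_exp.2 ?_))
    -- The factor `16 d² N` is `1 / s²`, and `q²` comes from using `q t` in place of `t`; this fixes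
    -- `varianceProxy`.
    calc _ = M * (√(N : ℝ) ^ 2) * t ^ 2 := by
          rw [hM, varianceProxy]
          field_simp
          norm_num
      _ ≤ M * (N : ℝ) ^ (1 + δ) * t ^ 2 := by
          rw [hsq2]
          gcongr
          calc (N : ℝ) = (N : ℝ) ^ (1 : ℝ) := (Real.rpow_one _).symm
            _ ≤ (N : ℝ) ^ (1 + δ) := Real.rpow_le_rpow_of_exponent_le hNR (by linarith)
  -- the decomposition
  have hi := h.integrable_logMinor E
  have hae := h.ae_logMinor_union E hd12 hnear
  have hint : ∫ ω, R ω ∂μ = ∫ ω, logMinor E Λ (sampleState V U ω) ∂μ -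
      (∫ ω, logMinor E Λ₁ (sampleState V U ω) ∂μ +
        ∫ ω, logMinor E Λ₂ (sampleState V U ω) ∂μ) := by
    rw [hR, integral_sub (hi Λ) (hi _), integral_congr_ae hae, integral_add (hi Λ₁) (hi Λ₂)]
  have hindep : IndepFun (fun ω => logMinor E Λ₁ (sampleState V U ω) -
      ∫ ω', logMinor E Λ₁ (sampleState V U ω') ∂μ) (fun ω => logMinor E Λ₂ (sampleState V U ω) -
      ∫ ω', logMinor E Λ₂ (sampleState V U ω') ∂μ) μ :=
    (h.indepFun_logMinor E hr₁ hr₂ hd12).comp (measurable_id.sub_const _)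
      (measurable_id.sub_const _)
  refine le_trans (le_of_eq (lintegral_congr_ae ?_))
    (lintegral_exp_add_add_le ((hm Λ₁).sub_const _) ((hm Λ₂).sub_const _) (hRm.sub_const _)
      hindep hpq (t := t) (c := M * (N : ℝ) ^ (1 + δ) * t ^ 2) ?_
      (hhalf Λ₁ hr₁ hc₁) (hhalf Λ₂ hr₂ hc₂) hthird)
  · filter_upwards [hae] with ω hω
    congr 3
    rw [hint]
    simp only [hR]
    rw [hω]
    ring
  -- The two halves together fit into the budget of `Λ`, the factor `p² = 2^δ` being the gain from
  -- halving.
  · have := two_rpow_mul_add_rpow_le (n := N) (n₁ := Λ₁.card) (n₂ := Λ₂.card) (Nat.cast_nonneg _)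
      (Nat.cast_nonneg _) hδ.le (by exact_mod_cast hc₁) (by exact_mod_cast hc₂)
    calc _ = M * (2 ^ δ * ((Λ₁.card : ℝ) ^ (1 + δ) + (Λ₂.card : ℝ) ^ (1 + δ))) * t ^ 2 := by
          rw [← hp2]; ring
      _ ≤ _ := by gcongr

end IsRandomStripModel

/-! ### Tail bound and conclusion -/

/-- An exponential Chebyshev bound for both tails. -/
theorem measureReal_lt_abs_le {Ω : Type*} [MeasurableSpace Ω] {μ : Measure Ω}
    [IsProbabilityMeasure μ] {X : Ω → ℝ} (hX : Measurable X) {t a K B : ℝ} (ht : 0 < t)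
    (hta : t * a = K) (hB : 0 ≤ B)
    (h1 : ∫⁻ ω, ENNReal.ofReal (Real.exp (t * X ω)) ∂μ ≤ ENNReal.ofReal B)
    (h2 : ∫⁻ ω, ENNReal.ofReal (Real.exp (-t * X ω)) ∂μ ≤ ENNReal.ofReal B) :
    μ.real {ω | a < |X ω|} ≤ 2 * B * Real.exp (-K) := by
  set f : Ω → ENNReal := fun ω => ENNReal.ofReal (Real.exp (t * X ω)) +
    ENNReal.ofReal (Real.exp (-t * X ω)) with hf
  have hfi : ∫⁻ ω, f ω ∂μ ≤ ENNReal.ofReal (2 * B) := by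
    rw [hf, lintegral_add_left (by fun_prop), two_mul, ENNReal.ofReal_add hB hB]
    exact add_le_add h1 h2
  have hsub : {ω | a < |X ω|} ⊆ {ω | ENNReal.ofReal (Real.exp K) ≤ f ω} := by
    intro ω hω
    have hω : a < |X ω| := hω
    have h3 : K ≤ t * |X ω| := by rw [← hta]; gcongr
    rw [Set.mem_ofPred_eq, hf]
    rcases abs_choice (X ω) with h4 | h4 <;> rw [h4] at h3
    · exact (ENNReal.ofReal_le_ofReal (Real.exp_le_exp.2 h3)).trans le_self_add
    · exact (ENNReal.ofReal_le_ofReal (Real.exp_le_exp.2 (by linarith))).trans le_add_self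
  have hmark := mul_meas_ge_le_lintegral (μ := μ) (f := f) (by fun_prop)
    (ENNReal.ofReal (Real.exp K))
  have h5 : ENNReal.ofReal (Real.exp K) * μ {ω | a < |X ω|} ≤ ENNReal.ofReal (2 * B) :=
    (mul_le_mul' le_rfl (measure_mono hsub)).trans (hmark.trans hfi)
  have h6 := ENNReal.toReal_mono ENNReal.ofReal_ne_top h5
  rw [ENNReal.toReal_mul, ENNReal.toReal_ofReal (Real.exp_pos K).le,
    ENNReal.toReal_ofReal (by positivity)] at h6
  rw [Real.exp_neg, ← div_eq_mul_inv, le_div_iff₀ (Real.exp_pos K), mul_comm]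
  exact h6

/-- The threshold for the size of the rectangles. -/
theorem exists_size_threshold {c M ε : ℝ} (hc : 0 < c) (hε : 0 < ε) :
    ∃ C : ℝ, ∀ x : ℝ, C ≤ x → 1 ≤ x ∧ x ^ (-ε) ≤ c ∧ M * x ^ (-ε) ≤ 1 := by
  have h1 := tendsto_rpow_neg_atTop hε
  have h2 : Filter.Tendsto (fun x : ℝ => M * x ^ (-ε)) Filter.atTop (nhds 0) := by
    simpa using h1.const_mul M
  obtain ⟨C, hC⟩ := Filter.eventually_atTop.1 ((Filter.eventually_ge_atTop (1 : ℝ)).and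
    ((h1.eventually (eventually_le_nhds hc)).and
      (h2.eventually (eventually_le_nhds zero_lt_one))))
  exact ⟨C, hC⟩

/-- The size of the rectangles beyond which the logarithm of the determinant concentrates only
depends on the parameters of the model. -/
theorem exists_concentration_threshold (d : ℕ) (D₀ D₁ absE ε : ℝ) :
    ∃ C₀ : ℝ, 0 < d → 0 < ε → ∀ E : ℝ, |E| = absE →
      ∀ {Ω : Type*} [MeasurableSpace Ω] (μ : Measure Ω) [IsProbabilityMeasure μ] (W : ℕ)
        (V : Strip W → Ω → ℝ) (U : ℤ → Ω → Matrix (Fin W) (Fin W) ℝ),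
        IsRandomStripModel μ d D₀ D₁ V U →
      ∀ Λ : Finset (Strip W), IsRectangular Λ → C₀ ≤ (Λ.card : ℝ) → ∀ K : ℝ, 4 ≤ K →
        μ.real {ω | (Λ.card : ℝ) ^ (1 / 2 + ε) * K <
            |logMinor E Λ (sampleState V U ω) -
              ∫ ω', logMinor E Λ (sampleState V U ω') ∂μ|} ≤ Real.exp (-K / 2) := by
  -- The threshold is produced before positivity is assumed, so degenerate parameters receive the
  -- value 0.
  by_cases hdε : 0 < d ∧ 0 < ε
  swap
  · exact ⟨0, fun h1 h2 => absurd ⟨h1, h2⟩ hdε⟩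
  obtain ⟨hd, hε⟩ := hdε
  have hdR : (0 : ℝ) < d := by exact_mod_cast hd
  -- `δ ≤ 1` is required by the recursion, and `δ ≤ ε` gives `N^(1+δ) t² ≤ N^(-ε)` for the `t`
  -- chosen below. The exponent `q` depends on `ε` only.
  set δ : ℝ := min ε 1 with hδ
  have hδ0 : 0 < δ := lt_min hε one_pos
  have hpq := Real.HolderConjugate.conjExponent
    (Real.one_lt_rpow one_lt_two (show 0 < δ / 2 by positivity))
  set q := Real.conjExponent ((2 : ℝ) ^ (δ / 2)) with hq
  have hq0 : 0 < q := hpq.symm.pos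
  obtain ⟨C₀, hC₀⟩ := exists_size_threshold (c := 1 / (8 * q * d))
    (M := varianceProxy d D₀ D₁ absE q) (by positivity) hε
  refine ⟨C₀, fun _ _ E hE Ω _ μ _ W V U h Λ hΛ hcard K hK => ?_⟩
  obtain ⟨hN, hc, hM⟩ := hC₀ _ hcard
  set N : ℝ := (Λ.card : ℝ) with hNdef
  have hN0 : 0 < N := by linarith
  -- With this `t` the deviation `N^(1/2+ε) K` becomes exactly `K` in the exponent, while `t √N =
  -- N^(-ε)` is admissible for large `N`.
  set t : ℝ := N ^ (-(1 / 2 + ε)) with ht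
  have ht0 : 0 < t := Real.rpow_pos_of_pos hN0 _
  have hts : t * √N ≤ 1 / (8 * q * d) := by
    rw [ht, Real.sqrt_eq_rpow, ← Real.rpow_add hN0,
      show -(1 / 2 + ε) + 1 / 2 = -ε by ring]
    exact hc
  have hexp : varianceProxy d D₀ D₁ |E| q * N ^ (1 + δ) * t ^ 2 ≤ 1 := by
    rw [hE]
    refine le_trans ?_ hM
    rw [mul_assoc, ht, ← Real.rpow_natCast, ← Real.rpow_mul hN0.le, ← Real.rpow_add hN0]
    refine mul_le_mul_of_nonneg_left (Real.rpow_le_rpow_of_exponent_le hN ?_)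
      (varianceProxy_nonneg _ _ _ _ _)
    have : δ ≤ ε := min_le_left _ _
    push_cast
    linarith
  have hX := (h.measurable_logMinor_sampleState E Λ).sub_const
    (∫ ω', logMinor E Λ (sampleState V U ω') ∂μ)
  have key : ∀ r : ℝ, |r| = t → ∫⁻ ω, ENNReal.ofReal (Real.exp (r *
      (logMinor E Λ (sampleState V U ω) - ∫ ω', logMinor E Λ (sampleState V U ω') ∂μ))) ∂μ ≤
      ENNReal.ofReal (Real.exp 1) := by
    intro r hr
    refine (h.lintegral_exp_centered_logMinor_le E hd hδ0 (min_le_right _ _) hpq Λ.card Λ hΛ rfl r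
      (by rw [hr]; exact hts)).trans (ENNReal.ofReal_le_ofReal (Real.exp_le_exp.2 ?_))
    rw [← sq_abs r, hr]
    exact hexp
  refine (measureReal_lt_abs_le hX ht0 (K := K) ?_ (Real.exp_pos 1).le
    (key t (abs_of_pos ht0)) (key (-t) (by rw [abs_neg, abs_of_pos ht0]))).trans ?_
  · rw [ht, ← mul_assoc, ← Real.rpow_add hN0, neg_add_cancel, Real.rpow_zero, one_mul]
  -- The prefactor `2e` is at most `e²`, and `2 - K ≤ -K/2` exactly when `K ≥ 4`; hence the absolute
  -- constant.
  · have h2e : (2 : ℝ) ≤ Real.exp 1 := by linarith [Real.add_one_le_exp (1 : ℝ)]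
    calc 2 * Real.exp 1 * Real.exp (-K) ≤ Real.exp 1 * Real.exp 1 * Real.exp (-K) := by gcongr
      _ = Real.exp (1 + 1 + -K) := by rw [Real.exp_add, Real.exp_add]
      _ ≤ Real.exp (-K / 2) := Real.exp_le_exp.2 (by linarith)

end
theorem theorem1p3 :
    ∃ (K₀ : ℝ) (C₀ : (d : ℕ) → (D₀ D₁ absE ε : ℝ) → ℝ),
      ∀ (d : ℕ) (D₀ D₁ E ε : ℝ), 0 < d → 0 < ε →
      ∀ {Ω : Type*} [MeasurableSpace Ω] (μ : Measure Ω) [IsProbabilityMeasure μ] (W : ℕ)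
        (V : Strip W → Ω → ℝ) (U : ℤ → Ω → Matrix (Fin W) (Fin W) ℝ),
        IsRandomStripModel μ d D₀ D₁ V U →
      ∀ Λ : Finset (Strip W), IsRectangular Λ → C₀ d D₀ D₁ |E| ε ≤ (Λ.card : ℝ) →
        (∀ᵐ ω ∂μ, dirichletDet (fun i => V i ω) (fun n => U n ω) E Λ ≠ 0) ∧
        Integrable
          (fun ω => Real.log |dirichletDet (fun i => V i ω) (fun n => U n ω) E Λ|) μ ∧
        ∀ K : ℝ, K₀ ≤ K →
          μ.real {ω | (Λ.card : ℝ) ^ (1 / 2 + ε) * K <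
              |Real.log |dirichletDet (fun i => V i ω) (fun n => U n ω) E Λ| -
                ∫ ω', Real.log |dirichletDet (fun i => V i ω') (fun n => U n ω') E Λ| ∂μ|}
            ≤ Real.exp (-K / 2) := by
  choose C₀ hC₀ using exists_concentration_threshold
  refine ⟨4, C₀, fun d D₀ D₁ E ε hd hε Ω _ μ _ W V U h Λ hΛ hcard => ?_⟩
  simp only [dirichletDet_eq_principalMinor]
  exact ⟨h.ae_principalMinor_ne_zero E Λ, h.integrable_logMinor E Λ,
    hC₀ d D₀ D₁ |E| ε hd hε E rfl μ W V U h Λ hΛ hcard⟩
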